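/- Let $N\ge 0$ and $1\le M_1\le M$ be integers, let $\mu,\lambda,\sigma$ be real with $\sigma\ne 0$, let $p_n\neq 0$, $r_n$, $\varphi_{n,0}$ ($M_1<n\le M$) be real, and let $k_j$, $\eta_{j,0}$, $\alpha_j^{(n)}$ ($1\le j\le N$, $1\le n\le M_1$) be complex. Let $r$ be real with $r^2=\sum_{n=M_1+1}^{M}r_n^2$. For $1\le j\le N$ and real $x,t$ put $$\eta_j=k_jx+\frac{\mu+\lambda}{k_j}t+\eta_{j,0},\quad w_j=k_j,\quad \mu_j=1,\qquad \eta_{N+j}=\eta_j^*,\quad w_{N+j}=k_j^*,\quad \mu_{N+j}=-1,\quad \alpha_{N+j}^{(n)}=(\alpha_j^{(n)})^*,$$ and $\varphi_n=p_nx-\frac{\mu+\lambda}{p_n}t+\varphi_{n,0}$, where $^*$ is complex conjugation. Assume that $k_j\neq0$, $k_j+k_l\ne 0$ ($j\neq l$), $k_j+k_l^*\neq 0$, $k_j-k_l^*\ne 0$ and $$\frac2\sigma+\sum_{n=M_1+1}^{M}\frac{4p_n^2r_n^2}{(p_n^2+k_j^2)(p_n^2+k_l^{*2})}\ne 0\qquad(1\le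 j,l\le N),$$ so that the expressions below are defined. For symbols $s_1,\dots,s_{2m}$ with given skew-symmetric entries $(s,s')=-(s',s)$, the Pfaffian is defined by $(\,)=1$ and $(s_1,\dots,s_{2m})=\sum_{i=2}^{2m}(-1)^i(s_1,s_i)(s_2,\dots,\widehat{s_i},\dots,s_{2m})$. Define the entries by $$(a_j,a_l)=\frac{w_l-w_j}{w_l+w_j}e^{\eta_j+\eta_l},\qquad (a_j,b_l)=\delta_{jl},\qquad (d_l,a_j)=w_j^{\,l}e^{\eta_j},$$ $$(b_j,b_l)=\frac{(1-\mu_j\mu_l)\sum_{n=1}^{M_1}\alpha_j^{(n)}\alpha_l^{(n)}}{2(w_j^2-w_l^2)\Big(\frac2\sigma+\sum_{n=M_1+1}^{M}\frac{4p_n^2r_n^2}{(p_n^2+w_j^2)(p_n^2+w_l^2)}\Big)}\quad(\text{read as }0\text{ if }\mu_j=\mu_l),$$ $$(b_j,\beta_l)=\frac{1+\mu_j}{2}\alpha_j^{(l)},\qquad (a_j,\gamma_l)=\frac{2ip_lr_l}{w_j+ip_l}e^{\eta_j},\qquad (d_l,\gamma_n)=\delta_{0l}\,r_n,$$ $$(a_j,\beta_l)=(b_j,\gamma_l)=(d_l,b_j)=(d_l,d_j)=(d_l,\beta_n)=0,$$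 and write $\bullet$ for $a_1,\dots,a_{2N},b_{2N},\dots,b_1$. Then the smooth functions of $(x,t)\in\mathbb R^2$ $$f=(\bullet),\qquad g_j=(d_0,\beta_j,\bullet)\ (1\le j\le M_1),\qquad g_j=e^{i\varphi_j}(d_0,\gamma_j,\bullet)\ (M_1<j\le M)$$ solve the bilinear $M$-component AB system $$D_xD_t\,g_j\cdot f=(\mu+\lambda)\,g_jf\quad(1\le j\le M),\qquad (D_x^2+r^2\sigma)\,f\cdot f=\sigma\sum_{j=1}^{M}|g_j|^2,$$ where $D_x^mD_t^n\,F\cdot G=\partial_\epsilon^m\partial_\delta^n\big[F(x+\epsilon,t+\delta)\,G(x-\epsilon,t-\delta)\big]_{\epsilon=\delta=0}$. -/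

import Mathlib

/-- The Pfaffian of a skew-symmetric array (only the entries above the diagonal are read), by
expansion along the first row:
`pf(0,1,…,n+1) = ∑_{j=1}^{n+1} (-1)^(j-1) (0,j) pf(1,…,ĵ,…,n+1)`, with `pf() = 1`.
It is `0` for arrays of odd order. -/
def pfaffian : (n : ℕ) → Matrix (Fin n) (Fin n) ℂ → ℂ
  | 0, _ => 1
  | 1, _ => 0
  | n + 2, A => ∑ j : Fin (n + 1), (-1) ^ (j : ℕ) * A 0 j.succ *
      pfaffian n (A.submatrix (fun u => (j.succAbove u).succ) (fun v => (j.succAbove v).succ))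

/-- The Pfaffian `(s₁, s₂, …, sₙ)` of a list of symbols with respect to the Pfaffian entries
`E s s' = (s, s')`. -/
def pfaffianList {S : Type*} (E : S → S → ℂ) (L : List S) : ℂ :=
  pfaffian L.length (Matrix.of fun i j => E (L.get i) (L.get j))

/-- The Hirota operator `D_x^m D_t^n F · G`. -/
noncomputable def hirotaD (m n : ℕ) (F G : ℝ → ℝ → ℂ) (x t : ℝ) : ℂ :=
  iteratedDeriv m (fun ε : ℝ =>
    iteratedDeriv n (fun δ : ℝ => F (x + ε) (t + δ) * G (x - ε) (t - δ)) 0) 0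

/-- The symbols occurring in the Pfaffians: `d_l` (`l ∈ ℤ`), `a_j`, `b_j`, `β_n`, `γ_n`. -/
inductive PfSymbol where
  | d (l : ℤ)
  | a (j : ℕ)
  | b (j : ℕ)
  | β (n : ℕ)
  | γ (n : ℕ)

/-- The parameters of the bright-dark `N`-soliton formulas (data only). Indices are 1-based:
soliton indices are `1 ≤ j ≤ N`, component indices are `1 ≤ n ≤ M`, the components `n ≤ M₁` are
bright and the components `M₁ < n ≤ M` are dark; values at other indices are never used. -/
structure ABParams where
  /-- number of solitons -/
  N : ℕ
  /-- number of components -/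
  M : ℕ
  /-- number of bright components -/
  M₁ : ℕ
  μ : ℝ
  lam : ℝ
  σ : ℝ
  /-- wave numbers `k_j`, `1 ≤ j ≤ N` -/
  k : ℕ → ℂ
  /-- phase constants `η_{j,0}`, `1 ≤ j ≤ N` -/
  η₀ : ℕ → ℂ
  /-- polarizations: `α n j` is `α_j^{(n)}`, `1 ≤ j ≤ N`, `1 ≤ n ≤ M₁` -/
  α : ℕ → ℕ → ℂ
  /-- wave numbers `p_n` of the dark background, `M₁ < n ≤ M` -/
  p : ℕ → ℝ
  /-- amplitudes `r_n` of the dark background, `M₁ < n ≤ M` -/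
  r : ℕ → ℝ
  /-- phase constants `φ_{n,0}`, `M₁ < n ≤ M` -/
  φ₀ : ℕ → ℝ

namespace ABParams

open PfSymbol ComplexConjugate

/-- Extension of a family `c_1,…,c_N` to `c_1,…,c_{2N}` by `c_{N+j} = conj c_j`. -/
noncomputable def ext (P : ABParams) (c : ℕ → ℂ) (j : ℕ) : ℂ :=
  if j ≤ P.N then c j else conj (c (j - P.N))

/-- `w_j = k_j` for `1 ≤ j ≤ N`, `w_j = conj k_{j-N}` for `N + 1 ≤ j ≤ 2N`. -/
noncomputable def w (P : ABParams) (j : ℕ) : ℂ := P.ext P.k j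

/-- The signs `μ_j`: `1` for `1 ≤ j ≤ N` and `-1` for `N + 1 ≤ j ≤ 2N`. -/
def sgn (P : ABParams) (j : ℕ) : ℂ := if j ≤ P.N then 1 else -1

/-- `α_j^{(n)}` for `1 ≤ j ≤ 2N`, with `α_{N+j}^{(n)} = conj α_j^{(n)}`. -/
noncomputable def α' (P : ABParams) (n j : ℕ) : ℂ := P.ext (P.α n) j

/-- The phases `η_j = k_j x + (μ+λ)/k_j t + η_{j,0}`, with `η_{N+j} = conj η_j`. -/
noncomputable def η (P : ABParams) (x t : ℝ) (j : ℕ) : ℂ :=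
  P.ext (fun i => P.k i * x + ((P.μ + P.lam : ℝ) : ℂ) / P.k i * t + P.η₀ i) j

/-- The phases `φ_n = p_n x - (μ+λ)/p_n t + φ_{n,0}` of the dark components. -/
noncomputable def φ (P : ABParams) (x t : ℝ) (n : ℕ) : ℝ :=
  P.p n * x - (P.μ + P.lam) / P.p n * t + P.φ₀ n

/-- `2/σ + ∑_{n=M₁+1}^M 4 p_n² r_n² / ((p_n² + z²)(p_n² + z'²))`. -/
noncomputable def factor (P : ABParams) (z z' : ℂ) : ℂ :=
  2 / (P.σ : ℂ) + ∑ n ∈ Finset.Icc (P.M₁ + 1) P.M,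
    4 * (P.p n : ℂ) ^ 2 * (P.r n : ℂ) ^ 2 /
      (((P.p n : ℂ) ^ 2 + z ^ 2) * ((P.p n : ℂ) ^ 2 + z' ^ 2))

/-- The Pfaffian entries `(s, s')` at the point `(x, t)`, extended by `(s', s) = -(s, s')`.
Entries between two of the symbols `β`, `γ` do not occur in the Pfaffians below. -/
noncomputable def entry (P : ABParams) (x t : ℝ) : PfSymbol → PfSymbol → ℂ
  | a j, a l => (P.w l - P.w j) / (P.w l + P.w j) * Complex.exp (P.η x t j + P.η x t l)
  | a j, b l => if j = l then 1 else 0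
  | b l, a j => -(if j = l then 1 else 0)
  | b j, b l =>
      ((1 - P.sgn j * P.sgn l) * ∑ n ∈ Finset.Icc 1 P.M₁, P.α' n j * P.α' n l) /
        (2 * (P.w j ^ 2 - P.w l ^ 2) * P.factor (P.w j) (P.w l))
  | b j, β l => (1 + P.sgn j) / 2 * P.α' l j
  | β l, b j => -((1 + P.sgn j) / 2 * P.α' l j)
  | a j, γ l => 2 * Complex.I * P.p l * P.r l / (P.w j + Complex.I * P.p l) *
      Complex.exp (P.η x t j)
  | γ l, a j => -(2 * Complex.I * P.p l * P.r l / (P.w j + Complex.I * P.p l) *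
      Complex.exp (P.η x t j))
  | d l, a j => P.w j ^ l * Complex.exp (P.η x t j)
  | a j, d l => -(P.w j ^ l * Complex.exp (P.η x t j))
  | d l, γ n => if l = 0 then (P.r n : ℂ) else 0
  | γ n, d l => -(if l = 0 then (P.r n : ℂ) else 0)
  | a _, β _ => 0
  | β _, a _ => 0
  | b _, γ _ => 0
  | γ _, b _ => 0
  | d _, d _ => 0
  | d _, b _ => 0
  | b _, d _ => 0
  | d _, β _ => 0
  | β _, d _ => 0
  | β _, β _ => 0
  | β _, γ _ => 0
  | γ _, β _ => 0
  | γ _, γ _ => 0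

/-- The list `• = a_1, …, a_{2N}, b_{2N}, …, b_1`. -/
def bullet (P : ABParams) : List PfSymbol :=
  (List.range' 1 (2 * P.N)).map a ++ (List.range' 1 (2 * P.N)).reverse.map b

/-- `f = (a_1, …, a_{2N}, b_{2N}, …, b_1)`. -/
noncomputable def f (P : ABParams) (x t : ℝ) : ℂ :=
  pfaffianList (P.entry x t) P.bullet

/-- `g_j = (d_0, β_j, •)` for `j ≤ M₁` (bright), `g_j = e^{iφ_j} (d_0, γ_j, •)` for `j > M₁`
(dark). -/
noncomputable def g (P : ABParams) (j : ℕ) (x t : ℝ) : ℂ :=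
  if j ≤ P.M₁ then pfaffianList (P.entry x t) (d 0 :: β j :: P.bullet)
  else Complex.exp (Complex.I * P.φ x t j) *
    pfaffianList (P.entry x t) (d 0 :: γ j :: P.bullet)

end ABParams

/-! Take the symbols `a_j`, `b_j` as a basis of a vector space `V`, with their entries as a skew
form `S`. Let `W` be the functional on the exterior algebra of `V` that sends a product of basis
vectors to its Pfaffian. It is determined by `W(1) = 1` and by trading multiplication by `v` for
contraction by `vS` (`wick_ι_mul`, `pfaffian_eq_wick`). If `X` is the product of all the symbols of
`•`, then `f = W(X)`, and symbols placed in front of `•` act as contractions by their rows, apart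
from the entry between them (`pfaffian_cons_cons`).

First equation. An `x`- or `t`-derivative cancels the denominators `w_j + w_l`, so the derivative of
`S` is of rank two, built from the rows `d_0, d_1` or `d_{-1}, d_0`. Differentiating `W` therefore
inserts two contractions (`hasDerivAt_wick`). Up to the factor `r_n`, a dark component is the
Pfaffian `f` with one more wave adjoined, of amplitude `e^{iφ_n}` and wave number `i p_n`; a bright
component has a constant extra row. In both cases the equation reduces to the three-term Plücker
relation for the rows `d_1, d_0, d_{-1}` and the extra row (`hirotaD_component`). That relation
holds because `X` has top degree (`wick_plucker`).

Second equation. Let `A`, `B` be the blocks of entries `(a,a)`, `(b,b)`, and let `e` be the vector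
of amplitudes. If `ψ + ABψ = e`, the quotients by `f` of the Pfaffians involved are linear
expressions in `ψ` or `Bψ`. Substituting the wave equation into weighted sums of `ψ_j (Bψ)_j`
evaluates both `D_x²` and the dark norms (`IsWave.sum_sq`, `IsWave.norm_dark`). The formula for
`(b_j, b_l)`, multiplied by `ψ_j ψ_l` and summed, then gives the equation (`IsWave.energy`). Reality
of `f` turns `|f|²` into `f²`.

Both arguments need `1 + AB` invertible. Scaling the amplitudes by a real `a` makes its determinant
a nonzero polynomial in `a`, so the general case follows by continuity as `a → 1` (`eq_of_isUnit`).
-/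

section

open ExteriorAlgebra Matrix ComplexConjugate

/-! ### Pfaffians as a Wick functional on the exterior algebra -/

section Wick

variable {ι : Type*} [Fintype ι] [DecidableEq ι]

/-- The alternating form attached to (the skew part of) a matrix. -/
noncomputable def altForm (A : Matrix ι ι ℂ) : LinearMap.BilinForm ℂ (ι → ℂ) :=
  Matrix.toBilin' ((1 / 2 : ℂ) • (A - Aᵀ))

/-- An alternating form vanishes on the diagonal, so changing the Clifford form by it maps the
exterior algebra to itself. The difference `0 - 0` is the shape that `changeForm` expects. The minus
sign compensates the one in front of the contraction in `changeForm_ι_mul`. -/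
theorem neg_altForm_toQuadraticMap (A : Matrix ι ι ℂ) :
    (-altForm A).toQuadraticMap = (0 : QuadraticForm ℂ (ι → ℂ)) - 0 := by
  ext v
  have h : v ⬝ᵥ Aᵀ *ᵥ v = v ⬝ᵥ A *ᵥ v := by
    rw [Matrix.mulVec_transpose, dotProduct_comm, ← Matrix.dotProduct_mulVec]
  simp only [LinearMap.BilinMap.toQuadraticMap_apply, altForm, LinearMap.neg_apply,
    Matrix.toBilin'_apply', Matrix.smul_mulVec, Matrix.sub_mulVec, dotProduct_smul, dotProduct_sub, h]
  simp

/-- The Wick functional of a skew-symmetric matrix: it sends a product of basis vectors to the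
Pfaffian of the corresponding entries. -/
noncomputable def wick (A : Matrix ι ι ℂ) : ExteriorAlgebra ℂ (ι → ℂ) →ₗ[ℂ] ℂ :=
  (algebraMapInv (R := ℂ) (M := ι → ℂ)).toLinearMap ∘ₗ
    CliffordAlgebra.changeForm (neg_altForm_toQuadraticMap A)

/-- Contraction with the functional `v ↦ u ⬝ᵥ v`. -/
noncomputable def contr (u : ι → ℂ) :
    ExteriorAlgebra ℂ (ι → ℂ) →ₗ[ℂ] ExteriorAlgebra ℂ (ι → ℂ) :=
  CliffordAlgebra.contractLeft (dotProductEquiv ℂ ι u)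

theorem contr_smul (c : ℂ) (v : ι → ℂ) (X : ExteriorAlgebra ℂ (ι → ℂ)) :
    contr (c • v) X = c • contr v X := by
  simp [contr]

theorem contr_sub (u v : ι → ℂ) (X : ExteriorAlgebra ℂ (ι → ℂ)) :
    contr (u - v) X = contr u X - contr v X := by
  simp [contr]

theorem contr_self (u : ι → ℂ) (X : ExteriorAlgebra ℂ (ι → ℂ)) : contr u (contr u X) = 0 :=
  CliffordAlgebra.contractLeft_contractLeft _ _

theorem contr_comm (u v : ι → ℂ) (X : ExteriorAlgebra ℂ (ι → ℂ)) :
    contr u (contr v X) = -contr v (contr u X) :=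
  CliffordAlgebra.contractLeft_comm _ _ _

theorem contr_one (u : ι → ℂ) : contr u 1 = 0 := by
  unfold contr
  exact CliffordAlgebra.contractLeft_one (Q := (0 : QuadraticForm ℂ (ι → ℂ)))
    (dotProductEquiv ℂ ι u)

theorem contr_ι_mul (u v : ι → ℂ) (X : ExteriorAlgebra ℂ (ι → ℂ)) :
    contr u (ExteriorAlgebra.ι ℂ v * X) = (u ⬝ᵥ v) • X - ExteriorAlgebra.ι ℂ v * contr u X := by
  simp only [contr]
  exact (CliffordAlgebra.contractLeft_ι_mul _ _ _).trans (by simp [ExteriorAlgebra.ι])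

theorem contr_eq_sum (u : ι → ℂ) (X : ExteriorAlgebra ℂ (ι → ℂ)) :
    contr u X = ∑ i, u i • contr (Pi.single i 1) X := by
  conv_lhs => rw [pi_eq_sum_univ' u]
  simp only [contr, map_sum, LinearMap.sum_apply, map_smul, LinearMap.smul_apply]

theorem contr_ιMulti (u : ι → ℂ) (n : ℕ) (v : Fin (n + 1) → ι → ℂ) :
    contr u (ιMulti ℂ (n + 1) v) =
      ∑ j : Fin (n + 1), ((-1) ^ (j : ℕ) * (u ⬝ᵥ v j)) • ιMulti ℂ n (fun i => v (j.succAbove i)) := by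
  induction n with
  | zero =>
    rw [ιMulti_succ_apply, contr_ι_mul, ιMulti_zero_apply, contr_one]
    simp
  | succ n ih =>
    rw [ιMulti_succ_apply, contr_ι_mul, ih, Fin.sum_univ_succ (n := n + 1), Finset.mul_sum,
      sub_eq_add_neg, ← Finset.sum_neg_distrib]
    simp only [Fin.val_zero, pow_zero, one_mul, Fin.zero_succAbove]
    congr 1
    refine Finset.sum_congr rfl fun j _ => ?_
    rw [ιMulti_succ_apply (fun i => v (j.succ.succAbove i)), mul_smul_comm, ← neg_smul]
    congr 1
    · simp [pow_succ, Matrix.vecTail]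
    · simp [Matrix.vecTail, Function.comp_def]

theorem wick_one (A : Matrix ι ι ℂ) : wick A 1 = 1 := by
  simp only [wick, LinearMap.comp_apply]
  rw [show CliffordAlgebra.changeForm (neg_altForm_toQuadraticMap A) 1 = 1 from
    CliffordAlgebra.changeForm_one _]
  simp

/-- Change of form turns multiplication by `v` into multiplication by `v` plus contraction by the
form, and the first summand has no scalar part. This is expansion of a Pfaffian along its first row;
read backwards, it turns contractions by vectors `v ᵥ* A` into products. -/
theorem wick_ι_mul {A : Matrix ι ι ℂ} (hA : Aᵀ = -A) (v : ι → ℂ)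
    (X : ExteriorAlgebra ℂ (ι → ℂ)) :
    wick A (ExteriorAlgebra.ι ℂ v * X) = wick A (contr (v ᵥ* A) X) := by
  have h : altForm A v = dotProductEquiv ℂ ι (v ᵥ* A) := by
    ext i
    have : (1 / 2 : ℂ) • (A - Aᵀ) = A := by
      rw [hA]; ext i j; simp; ring
    simp only [altForm, this]
    simp [Matrix.toBilin'_apply', Matrix.vecMul, Matrix.col_def]
    rfl
  simp only [wick, LinearMap.comp_apply, contr, AlgHom.toLinearMap_apply]
  rw [show CliffordAlgebra.changeForm (neg_altForm_toQuadraticMap A) (ExteriorAlgebra.ι ℂ v * X) = _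
    from CliffordAlgebra.changeForm_ι_mul _ v X, CliffordAlgebra.changeForm_contractLeft, ← h]
  rw [map_sub, map_mul]
  simp only [LinearMap.neg_apply, map_neg, sub_neg_eq_add]
  have : algebraMapInv (R := ℂ) (M := ι → ℂ) ((CliffordAlgebra.ι (0 : QuadraticForm ℂ (ι → ℂ))) v)
    = 0 := by
    have := ExteriorAlgebra.lift_ι_apply ℂ (0 : (ι → ℂ) →ₗ[ℂ] ℂ) (fun _ => by simp) v
    exact this
  rw [this, zero_mul, zero_add]

theorem vecMul_ι {A : Matrix ι ι ℂ} (i : ι) : Pi.single i 1 ᵥ* A = A i := by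
  simp [Matrix.row_def]

/-- The product of the basis vectors indexed by a family. -/
noncomputable def mono {n : ℕ} (v : Fin n → ι) : ExteriorAlgebra ℂ (ι → ℂ) :=
  ιMulti ℂ n fun i => Pi.single (v i) 1

omit [Fintype ι] in
theorem mono_zero (v : Fin 0 → ι) : mono v = 1 := by
  simp [mono]

omit [Fintype ι] in
theorem mono_succ {n : ℕ} (v : Fin (n + 1) → ι) :
    mono v = ExteriorAlgebra.ι ℂ (Pi.single (v 0) 1) * mono fun i => v i.succ := by
  simp [mono, ιMulti_succ_apply, Matrix.vecTail, Function.comp_def]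

theorem contr_mono (u : ι → ℂ) {n : ℕ} (v : Fin (n + 1) → ι) :
    contr u (mono v) = ∑ j : Fin (n + 1), ((-1) ^ (j : ℕ) * u (v j)) •
      mono fun i => v (j.succAbove i) := by
  simp only [mono]
  rw [contr_ιMulti]
  simp

theorem wick_mono_one {A : Matrix ι ι ℂ} (hA : Aᵀ = -A) (v : Fin 1 → ι) : wick A (mono v) = 0 := by
  rw [mono_succ, mono_zero, wick_ι_mul hA, contr_one, map_zero]

theorem wick_mono_succ_succ {A : Matrix ι ι ℂ} (hA : Aᵀ = -A) {n : ℕ} (v : Fin (n + 2) → ι) :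
    wick A (mono v) = ∑ j : Fin (n + 1), (-1) ^ (j : ℕ) * A (v 0) (v j.succ) *
      wick A (mono fun i => v (j.succAbove i).succ) := by
  rw [mono_succ, wick_ι_mul hA, vecMul_ι, contr_mono, map_sum]
  simp

theorem pfaffian_eq_wick {A : Matrix ι ι ℂ} (hA : Aᵀ = -A) (n : ℕ) (v : Fin n → ι) :
    pfaffian n (Matrix.of fun i j => A (v i) (v j)) = wick A (mono v) := by
  induction n using Nat.twoStepInduction with
  | zero => simp [pfaffian, mono_zero, wick_one]
  | one => rw [wick_mono_one hA]; simp [pfaffian]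
  | more n ih _ =>
    rw [wick_mono_succ_succ hA, pfaffian]
    refine Finset.sum_congr rfl fun j _ => ?_
    rw [← ih]
    rfl

/-- Expansion of a Pfaffian along an extra first row. -/
theorem pfaffian_cons {A : Matrix ι ι ℂ} (hA : Aᵀ = -A) {n : ℕ} (v : Fin n → ι) (u : ι → ℂ)
    (C : Matrix (Fin (n + 1)) (Fin (n + 1)) ℂ) (h₀ : ∀ j, C 0 (Fin.succ j) = u (v j))
    (h : ∀ i j, C (Fin.succ i) (Fin.succ j) = A (v i) (v j)) :
    pfaffian (n + 1) C = wick A (contr u (mono v)) := by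
  cases n with
  | zero => simp [pfaffian, mono_zero, contr_one]
  | succ n =>
    rw [contr_mono, pfaffian, map_sum]
    refine Finset.sum_congr rfl fun j _ => ?_
    rw [h₀, map_smul, smul_eq_mul, ← pfaffian_eq_wick hA]
    congr 2
    ext a b
    simp [h]

/-- Expansion of a Pfaffian along two extra first rows. -/
theorem pfaffian_cons_cons {A : Matrix ι ι ℂ} (hA : Aᵀ = -A) {n : ℕ} (v : Fin n → ι)
    (u u' : ι → ℂ) (C : Matrix (Fin (n + 2)) (Fin (n + 2)) ℂ)
    (h₀ : ∀ j, C 0 (Fin.succ (Fin.succ j)) = u (v j))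
    (h₁ : ∀ j, C 1 (Fin.succ (Fin.succ j)) = u' (v j))
    (h : ∀ i j, C (Fin.succ (Fin.succ i)) (Fin.succ (Fin.succ j)) = A (v i) (v j)) :
    pfaffian (n + 2) C = C 0 1 * wick A (mono v) + wick A (contr u (contr u' (mono v))) := by
  -- The `j = 0` term pairs the two extra symbols with each other. In every other term the minor
  -- keeps only one extra row, so `pfaffian_cons` applies; swapping the contractions lets `u` act on
  -- the product first.
  rw [pfaffian, Fin.sum_univ_succ, contr_comm]
  congr 1
  · simp only [Fin.val_zero, pow_zero, one_mul, Fin.succ_zero_eq_one, Fin.zero_succAbove]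
    rw [← pfaffian_eq_wick hA]
    congr 2
    ext a b
    simp [h]
  · cases n with
    | zero => simp [mono_zero, contr_one]
    | succ n =>
      rw [contr_mono u, map_sum, map_neg, map_sum, ← Finset.sum_neg_distrib]
      refine Finset.sum_congr rfl fun j _ => ?_
      rw [h₀, map_smul, map_smul, smul_eq_mul, ← neg_mul,
        pfaffian_cons hA (fun i => v (j.succAbove i)) u' _ _ _]
      · simp [pow_succ]
      · intro i
        simpa using h₁ (j.succAbove i)
      · intro i i'
        simpa using h (j.succAbove i) (j.succAbove i')

end Wick

/-! ### Derivatives, Plücker relation and conjugation of the Wick functional -/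

section WickCalculus

variable {ι : Type*} [Fintype ι] [DecidableEq ι]

theorem ι_mul_mono (m : ι → ℂ) {n : ℕ} (v : Fin n → ι) :
    ExteriorAlgebra.ι ℂ m * mono v = ∑ i, m i • mono (Fin.cons i v : Fin (n + 1) → ι) := by
  conv_lhs => rw [pi_eq_sum_univ' m]
  simp [mono_succ, Finset.sum_mul]

theorem mem_span_mono (X : ExteriorAlgebra ℂ (ι → ℂ)) :
    X ∈ Submodule.span ℂ {Y | ∃ (n : ℕ) (v : Fin n → ι), Y = mono v} := by
  induction X using CliffordAlgebra.left_induction with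
  | algebraMap r =>
    rw [Algebra.algebraMap_eq_smul_one]
    exact Submodule.smul_mem _ _ (Submodule.subset_span ⟨0, Fin.elim0, (mono_zero _).symm⟩)
  | add x y hx hy => exact Submodule.add_mem _ hx hy
  | ι_mul x m hx =>
    refine Submodule.span_induction ?_ ?_ ?_ ?_ hx
    · rintro _ ⟨n, v, rfl⟩
      refine (ι_mul_mono m v).symm ▸ Submodule.sum_mem _ fun i _ => Submodule.smul_mem _ _
        (Submodule.subset_span ⟨_, _, rfl⟩)
    · simp
    · intro x y _ _ hx hy
      rw [mul_add]
      exact Submodule.add_mem _ hx hy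
    · intro a x _ hx
      rw [mul_smul_comm]
      exact Submodule.smul_mem _ _ hx

theorem mono_induction {p : ExteriorAlgebra ℂ (ι → ℂ) → Prop}
    (mono : ∀ (n : ℕ) (v : Fin n → ι), p (mono v)) (zero : p 0)
    (add : ∀ x y, p x → p y → p (x + y)) (smul : ∀ (a : ℂ) x, p x → p (a • x))
    (X : ExteriorAlgebra ℂ (ι → ℂ)) : p X := by
  refine Submodule.span_induction ?_ zero (fun x y _ _ => add x y) (fun a x _ => smul a x)
    (mem_span_mono X)
  rintro _ ⟨n, v, rfl⟩
  exact mono n v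

theorem contDiff_wick {E : Type*} [NormedAddCommGroup E] [NormedSpace ℝ E] {k : WithTop ℕ∞}
    {A : E → Matrix ι ι ℂ} (hA : ∀ x, (A x)ᵀ = -A x)
    (h : ∀ i j, ContDiff ℝ k fun x => A x i j) (X : ExteriorAlgebra ℂ (ι → ℂ)) :
    ContDiff ℝ k fun x => wick (A x) X := by
  induction X using mono_induction with
  | zero => simpa using contDiff_const
  | add x y hx hy => simpa using hx.add hy
  | smul a x hx => simpa using contDiff_const.mul hx
  | mono n v =>
    induction n using Nat.twoStepInduction with
    | zero => simpa [mono_zero, wick_one] using contDiff_const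
    | one => simpa [wick_mono_one (hA _)] using contDiff_const
    | more n ih _ =>
      simp only [wick_mono_succ_succ (hA _)]
      exact ContDiff.sum fun j _ => (contDiff_const.mul (h _ _)).mul (ih _)

/-- The Wick functional behaves like a Gaussian expectation, the exponential of a two-form acting by
contraction: varying the form in the direction of a rank-two form inserts the two corresponding
contractions. -/
theorem hasDerivAt_wick {A : ℝ → Matrix ι ι ℂ} (hA : ∀ x, (A x)ᵀ = -A x) {x₀ : ℝ} {u v : ι → ℂ}
    (h : ∀ i j, HasDerivAt (fun x => A x i j) (u i * v j - v i * u j) x₀)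
    (X : ExteriorAlgebra ℂ (ι → ℂ)) :
    HasDerivAt (fun x => wick (A x) X) (wick (A x₀) (contr v (contr u X))) x₀ := by
  induction X using mono_induction with
  | zero => simpa using hasDerivAt_const x₀ (0 : ℂ)
  | add x y hx hy => simpa using hx.fun_add hy
  | smul a x hx => simpa using hx.const_mul a
  | mono n w =>
    induction n using Nat.twoStepInduction with
    | zero => simpa [mono_zero, wick_one, contr_one] using hasDerivAt_const x₀ (1 : ℂ)
    | one =>
      simpa [wick_mono_one (hA _), contr_mono, mono_zero, contr_one] using
        hasDerivAt_const x₀ (0 : ℂ)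
    | more n ih _ =>
      simp only [wick_mono_succ_succ (hA _)]
      -- The product rule for the row expansion: a contraction hitting the first vector gives the
      -- derivative of an entry, and otherwise both contractions pass to the minor.
      have key : wick (A x₀) (contr v (contr u (mono w))) =
          ∑ j : Fin (n + 1), ((-1) ^ (j : ℕ) * (u (w 0) * v (w j.succ) - v (w 0) * u (w j.succ)) *
            wick (A x₀) (mono fun i => w (j.succAbove i).succ) +
            (-1) ^ (j : ℕ) * A x₀ (w 0) (w j.succ) *
              wick (A x₀) (contr v (contr u (mono fun i => w (j.succAbove i).succ)))) := by
        rw [mono_succ, contr_ι_mul, map_sub, contr_ι_mul, map_smul, map_sub, map_sub, map_smul,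
          map_smul, wick_ι_mul (hA _), vecMul_ι, contr_comm (A x₀ (w 0)), contr_comm (A x₀ (w 0)) u,
          map_neg (contr v), neg_neg, contr_mono u, contr_mono v, contr_mono (A x₀ (w 0))]
        simp only [map_sum, map_smul, smul_eq_mul, dotProduct_single, mul_one, Finset.mul_sum,
          ← Finset.sum_sub_distrib, sub_sub_eq_add_sub]
        refine Finset.sum_congr rfl fun j _ => ?_
        ring
      rw [key]
      refine HasDerivAt.fun_sum fun j _ => ?_
      exact ((h _ _).const_mul _).mul (ih _)

/-- A product rule for a general moving functional, so that it can be iterated with a functional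
already containing a contraction. -/
theorem hasDerivAt_contr {F : ℝ → ExteriorAlgebra ℂ (ι → ℂ) →ₗ[ℂ] ℂ}
    {F' : ExteriorAlgebra ℂ (ι → ℂ) →ₗ[ℂ] ℂ} {x₀ : ℝ} (hF : ∀ X, HasDerivAt (fun x => F x X) (F' X) x₀)
    {δ : ℝ → ι → ℂ} {δ' : ι → ℂ} (hδ : ∀ i, HasDerivAt (fun x => δ x i) (δ' i) x₀)
    (X : ExteriorAlgebra ℂ (ι → ℂ)) :
    HasDerivAt (fun x => F x (contr (δ x) X)) (F' (contr (δ x₀) X) + F x₀ (contr δ' X)) x₀ := by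
  have h₁ : ∀ x, F x (contr (δ x) X) = ∑ i, δ x i * F x (contr (Pi.single i 1) X) := fun x => by
    rw [contr_eq_sum]; simp
  have h₂ : F' (contr (δ x₀) X) + F x₀ (contr δ' X) =
      ∑ i, (δ' i * F x₀ (contr (Pi.single i 1) X) + δ x₀ i * F' (contr (Pi.single i 1) X)) := by
    rw [contr_eq_sum (δ x₀), contr_eq_sum δ']
    simp [Finset.sum_add_distrib, add_comm]
  simp only [h₁, h₂]
  exact HasDerivAt.fun_sum fun i _ => (hδ i).mul (hF _)

theorem hasDerivAt_wick_contr_contr {A : ℝ → Matrix ι ι ℂ} (hA : ∀ x, (A x)ᵀ = -A x) {x₀ : ℝ}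
    {u v : ι → ℂ} (h : ∀ i j, HasDerivAt (fun x => A x i j) (u i * v j - v i * u j) x₀)
    {δ ε : ℝ → ι → ℂ} {δ' ε' : ι → ℂ} (hδ : ∀ i, HasDerivAt (fun x => δ x i) (δ' i) x₀)
    (hε : ∀ i, HasDerivAt (fun x => ε x i) (ε' i) x₀) (X : ExteriorAlgebra ℂ (ι → ℂ)) :
    HasDerivAt (fun x => wick (A x) (contr (δ x) (contr (ε x) X)))
      (wick (A x₀) (contr v (contr u (contr (δ x₀) (contr (ε x₀) X)))) +
        wick (A x₀) (contr δ' (contr (ε x₀) X)) + wick (A x₀) (contr (δ x₀) (contr ε' X))) x₀ := by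
  refine hasDerivAt_contr (F := fun x => wick (A x) ∘ₗ contr (δ x))
    (F' := wick (A x₀) ∘ₗ contr v ∘ₗ contr u ∘ₗ contr (δ x₀) + wick (A x₀) ∘ₗ contr δ')
    (fun Y => ?_) hε X
  refine hasDerivAt_contr (F := fun x => wick (A x)) (F' := wick (A x₀) ∘ₗ contr v ∘ₗ contr u)
    (fun Z => ?_) hδ Y
  exact hasDerivAt_wick hA h Z

theorem contDiff_wick_contr_contr {E : Type*} [NormedAddCommGroup E] [NormedSpace ℝ E]
    {k : WithTop ℕ∞} {A : E → Matrix ι ι ℂ} (hA : ∀ x, (A x)ᵀ = -A x)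
    (h : ∀ i j, ContDiff ℝ k fun x => A x i j) {δ ε : E → ι → ℂ}
    (hδ : ∀ i, ContDiff ℝ k fun x => δ x i) (hε : ∀ i, ContDiff ℝ k fun x => ε x i)
    (X : ExteriorAlgebra ℂ (ι → ℂ)) :
    ContDiff ℝ k fun x => wick (A x) (contr (δ x) (contr (ε x) X)) := by
  have h₁ : ∀ x, wick (A x) (contr (δ x) (contr (ε x) X)) = ∑ j, ∑ i, ε x j * δ x i *
      wick (A x) (contr (Pi.single i 1) (contr (Pi.single j 1) X)) := fun x => by
    rw [contr_eq_sum (ε x), map_sum, map_sum]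
    refine Finset.sum_congr rfl fun j _ => ?_
    rw [contr_eq_sum (δ x)]
    simp [mul_left_comm, mul_assoc]
  simp only [h₁]
  exact ContDiff.sum fun j _ => ContDiff.sum fun i _ => ((hε j).mul (hδ i)).mul
    (contDiff_wick hA h _)

/-- Contracting an element of top degree with a functional represented by the form. -/
theorem wick_contr_contr_of_top {A : Matrix ι ι ℂ} (hA : Aᵀ = -A) {X : ExteriorAlgebra ℂ (ι → ℂ)}
    (hX : ∀ v, ExteriorAlgebra.ι ℂ v * X = 0) (v u : ι → ℂ) :
    wick A (contr (v ᵥ* A) (contr u X)) = (u ⬝ᵥ v) * wick A X := by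
  have h := contr_ι_mul u v X
  rw [hX, map_zero, eq_comm, sub_eq_zero] at h
  rw [← wick_ι_mul hA, ← h, map_smul, smul_eq_mul]

/-- Contraction by `v ᵥ* A` amounts to multiplication by `v`. Moving `v` inward past the three
contractions leaves one term for each of `a`, `b`, `c`, and the last term dies because `v` kills
`X`. The scalars `a ⬝ᵥ v` and so on, times `wick A X`, are again Pfaffians by
`wick_contr_contr_of_top`. -/
theorem wick_plucker_of_vecMul {A : Matrix ι ι ℂ} (hA : Aᵀ = -A) {X : ExteriorAlgebra ℂ (ι → ℂ)}
    (hX : ∀ v, ExteriorAlgebra.ι ℂ v * X = 0) (v a b c : ι → ℂ) :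
    wick A (contr (v ᵥ* A) (contr a (contr b (contr c X)))) * wick A X =
      wick A (contr (v ᵥ* A) (contr a X)) * wick A (contr b (contr c X)) -
      wick A (contr (v ᵥ* A) (contr b X)) * wick A (contr a (contr c X)) +
      wick A (contr (v ᵥ* A) (contr c X)) * wick A (contr a (contr b X)) := by
  have h₁ := contr_ι_mul c v X
  rw [hX, map_zero, eq_comm, sub_eq_zero] at h₁
  have h₂ := contr_ι_mul b v (contr c X)
  have h₃ := contr_ι_mul a v (contr b (contr c X))
  rw [eq_comm, sub_eq_iff_eq_add', ← sub_eq_iff_eq_add] at h₂ h₃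
  simp only [wick_contr_contr_of_top hA hX]
  rw [← wick_ι_mul hA, ← h₃, ← h₂, ← h₁]
  simp only [map_sub, map_smul, smul_eq_mul]
  ring

/-- The Plücker relation for Pfaffians. -/
theorem wick_plucker {A : Matrix ι ι ℂ} (hA : Aᵀ = -A) {X : ExteriorAlgebra ℂ (ι → ℂ)}
    (hX : ∀ v, ExteriorAlgebra.ι ℂ v * X = 0) (hsurj : ∀ u, ∃ v, v ᵥ* A = u) (u a b c : ι → ℂ) :
    wick A (contr u (contr a (contr b (contr c X)))) * wick A X =
      wick A (contr u (contr a X)) * wick A (contr b (contr c X)) -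
      wick A (contr u (contr b X)) * wick A (contr a (contr c X)) +
      wick A (contr u (contr c X)) * wick A (contr a (contr b X)) := by
  obtain ⟨v, rfl⟩ := hsurj u
  exact wick_plucker_of_vecMul hA hX v a b c

theorem ι_mul_mono_eq_zero {n : ℕ} {v : Fin n → ι} (hv : Function.Surjective v) (m : ι → ℂ) :
    ExteriorAlgebra.ι ℂ m * mono v = 0 := by
  rw [ι_mul_mono]
  refine Finset.sum_eq_zero fun i _ => ?_
  obtain ⟨j, rfl⟩ := hv i
  have : mono (Fin.cons (v j) v : Fin (n + 1) → ι) = 0 := by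
    refine ιMulti_eq_zero_of_not_inj fun h => ?_
    exact Fin.succ_ne_zero j (h (by simp))
  rw [this, smul_zero]

theorem conj_pfaffian (n : ℕ) (C : Matrix (Fin n) (Fin n) ℂ) :
    starRingEnd ℂ (pfaffian n C) = pfaffian n (C.map (starRingEnd ℂ)) := by
  induction n using Nat.twoStepInduction with
  | zero => simp [pfaffian]
  | one => simp [pfaffian]
  | more n ih _ =>
    simp only [pfaffian, map_sum, map_mul, map_pow, map_neg, map_one, ih]
    rfl

/-- If conjugating the entries permutes the symbols, conjugating a Pfaffian permutes them too. -/
theorem conj_wick_mono {A : Matrix ι ι ℂ} (hA : Aᵀ = -A) {τ : ι → ι}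
    (hτ : ∀ i j, starRingEnd ℂ (A i j) = A (τ i) (τ j)) {n : ℕ} (v : Fin n → ι) :
    starRingEnd ℂ (wick A (mono v)) = wick A (mono (τ ∘ v)) := by
  rw [← pfaffian_eq_wick hA, ← pfaffian_eq_wick hA, conj_pfaffian]
  congr 1
  ext i j
  simp [hτ]

end WickCalculus

/-! ### Algebra of the wave equation and the constraint -/

section SolitonAlgebra

variable {J : Type*} [Fintype J]

/-- The matrix `(w_l - w_j) / (w_l + w_j) e_j e_l`. -/
noncomputable def cauchyMatrix (w e : J → ℂ) : Matrix J J ℂ :=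
  Matrix.of fun j l => (w l - w j) / (w l + w j) * (e j * e l)

omit [Fintype J] in
theorem cauchyMatrix_skew (w e : J → ℂ) (j l : J) :
    cauchyMatrix w e l j = -cauchyMatrix w e j l := by
  simp only [cauchyMatrix, Matrix.of_apply, add_comm (w j), ← neg_sub (w j) (w l)]
  ring

/-- Reduces an identity of double sums to antisymmetry of the difference of the summands. -/
theorem sum_sum_eq_zero_of_skew {K : J → J → ℂ} (h : ∀ j l, K l j = -K j l) :
    ∑ j, ∑ l, K j l = 0 := by
  have : ∑ j, ∑ l, K j l = -∑ j, ∑ l, K j l := by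
    conv_lhs => rw [Finset.sum_comm]
    simp only [← Finset.sum_neg_distrib]
    exact Finset.sum_congr rfl fun j _ => Finset.sum_congr rfl fun l _ => h _ _
  exact self_eq_neg.1 this

/-- The quadratic form of `g * cauchyMatrix` for a weight `g` whose differences factor. -/
theorem sum_weight_cauchyMatrix {w : J → ℂ} (hw : ∀ j l, w j + w l ≠ 0) (e q : J → ℂ)
    {g c : J → ℂ} {κ : ℂ} (hg : ∀ j l, g j - g l = κ * ((w j ^ 2 - w l ^ 2) * (c j * c l))) :
    ∑ j, g j * q j * (cauchyMatrix w e *ᵥ q) j =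
      -κ * ((∑ j, c j * (w j ^ 2 * (e j * q j))) * (∑ j, c j * (e j * q j)) -
        (∑ j, c j * (w j * (e j * q j))) ^ 2) := by
  set a := fun j => c j * (e j * q j) with ha
  have h₁ : ∑ j, g j * q j * (cauchyMatrix w e *ᵥ q) j =
      ∑ j, ∑ l, g j * (q j * cauchyMatrix w e j l * q l) := by
    refine Finset.sum_congr rfl fun j _ => ?_
    rw [mulVec, dotProduct, Finset.mul_sum]
    exact Finset.sum_congr rfl fun l _ => by ring
  have h₂ : (∑ j, c j * (w j ^ 2 * (e j * q j))) * (∑ j, c j * (e j * q j)) -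
        (∑ j, c j * (w j * (e j * q j))) ^ 2 =
      ∑ j, ∑ l, (w j ^ 2 * a j * a l - w j * a j * (w l * a l)) := by
    rw [sq, Finset.sum_mul_sum, Finset.sum_mul_sum, ← Finset.sum_sub_distrib]
    refine Finset.sum_congr rfl fun j _ => ?_
    rw [← Finset.sum_sub_distrib]
    exact Finset.sum_congr rfl fun l _ => by simp only [ha]; ring
  rw [h₁, h₂, Finset.mul_sum, ← sub_eq_zero, ← Finset.sum_sub_distrib]
  simp only [Finset.mul_sum, ← Finset.sum_sub_distrib]
  refine sum_sum_eq_zero_of_skew fun j l => ?_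
  -- The weight difference supplies the factor `w_j + w_l` that clears the Cauchy denominator; what
  -- remains is polynomial and splits into products of single sums.
  have h₃ : (w j ^ 2 - w l ^ 2) * cauchyMatrix w e j l = -(w j - w l) ^ 2 * (e j * e l) := by
    have := hw l j
    simp only [cauchyMatrix, Matrix.of_apply]
    field_simp
    ring
  rw [cauchyMatrix_skew w e j l]
  simp only [ha]
  linear_combination (q j * cauchyMatrix w e j l * q l) * hg j l
    + κ * c j * c l * q j * q l * h₃

theorem mulVec_dotProduct_self_of_skew {B : Matrix J J ℂ} (hB : Bᵀ = -B) (q : J → ℂ) :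
    ∑ j, q j * (B *ᵥ q) j = 0 := by
  simp only [mulVec, dotProduct, Finset.mul_sum]
  refine sum_sum_eq_zero_of_skew fun j l => ?_
  have : B l j = -B j l := congrFun (congrFun hB j) l
  rw [this]
  ring

theorem sum_sub_mul_of_skew {B : Matrix J J ℂ} (hB : Bᵀ = -B) (g ψ : J → ℂ) :
    ∑ j, ∑ l, (g j - g l) * B j l * (ψ j * ψ l) = 2 * ∑ j, g j * ψ j * (B *ᵥ ψ) j := by
  have h : ∑ j, g j * ψ j * (B *ᵥ ψ) j = ∑ j, ∑ l, g j * ψ j * (B j l * ψ l) := by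
    refine Finset.sum_congr rfl fun j _ => ?_
    rw [mulVec, dotProduct, Finset.mul_sum]
  rw [h, ← sub_eq_zero, Finset.mul_sum, ← Finset.sum_sub_distrib]
  simp only [Finset.mul_sum, ← Finset.sum_sub_distrib]
  refine sum_sum_eq_zero_of_skew fun j l => ?_
  have : B l j = -B j l := congrFun (congrFun hB j) l
  rw [this]
  ring

theorem sum_sum_sum_comm (s : Finset ℕ) (F : J → J → ℕ → ℂ) :
    ∑ j, ∑ l, ∑ n ∈ s, F j l n = ∑ n ∈ s, ∑ j, ∑ l, F j l n := by
  rw [Finset.sum_comm]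
  rw [Finset.sum_comm (s := s)]
  rw [Finset.sum_comm]
  exact Finset.sum_congr rfl fun j _ => Finset.sum_comm

theorem sum_sum_symm_mul (u v ψ : J → ℂ) :
    ∑ j, ∑ l, (u j * v l + v j * u l) * (ψ j * ψ l) =
      2 * ((∑ j, u j * ψ j) * ∑ j, v j * ψ j) := by
  have h : ∀ a b : J → ℂ, ∑ j, ∑ l, a j * b l * (ψ j * ψ l) =
      (∑ j, a j * ψ j) * ∑ j, b j * ψ j := fun a b => by
    rw [Finset.sum_mul_sum]
    exact Finset.sum_congr rfl fun j _ => Finset.sum_congr rfl fun l _ => by ring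
  simp only [add_mul, Finset.sum_add_distrib, h]
  ring

/-- The algebraic data of the bright-dark soliton solutions: wave numbers with their conjugation
symmetry, polarizations `β`, and the form `B` solving the constraint equation. -/
structure SolitonData (J : Type*) [Fintype J] where
  w : J → ℂ
  τ : Equiv.Perm J
  B : Matrix J J ℂ
  σ : ℝ
  bright : Finset ℕ
  dark : Finset ℕ
  β : ℕ → J → ℂ
  p : ℕ → ℝ
  r : ℕ → ℝ
  σ_ne : σ ≠ 0
  w_add_ne : ∀ j l, w j + w l ≠ 0
  pole_ne : ∀ n ∈ dark, ∀ j, (p n : ℂ) ^ 2 + w j ^ 2 ≠ 0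
  τ_τ : ∀ j, τ (τ j) = j
  conj_w : ∀ j, conj (w j) = w (τ j)
  conj_B : ∀ j l, conj (B j l) = B (τ j) (τ l)
  B_skew : Bᵀ = -B
  -- The formula for `(b_j, b_l)` with its denominator cleared; a difference of the reciprocals is
  -- `w_j² - w_l²` over the product of the two poles.
  constraint : ∀ j l, 2 / (σ : ℂ) * ((w j ^ 2 - w l ^ 2) * B j l) +
    ∑ n ∈ dark, 4 * (p n : ℂ) ^ 2 * (r n : ℂ) ^ 2 *
      ((((p n : ℂ) ^ 2 + w l ^ 2)⁻¹ - ((p n : ℂ) ^ 2 + w j ^ 2)⁻¹) * B j l) =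
    ∑ n ∈ bright, (β n j * conj (β n (τ l)) + conj (β n (τ j)) * β n l)

namespace SolitonData

variable (D : SolitonData J)

/-- The wave equation `ψ + A B ψ = e` with the Cauchy-type matrix `A` of the amplitudes `e`. -/
def IsWave (e ψ : J → ℂ) : Prop := ψ + cauchyMatrix D.w e *ᵥ (D.B *ᵥ ψ) = e

variable {D} {e ψ : J → ℂ}

theorem IsWave.apply (h : D.IsWave e ψ) (j : J) :
    e j = ψ j + (cauchyMatrix D.w e *ᵥ (D.B *ᵥ ψ)) j :=
  (congrFun h j).symm

/-- Inserting the wave equation for `e` leaves the quadratic forms of `B` at `ψ` and of the Cauchy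
matrix at `Bψ`, both zero by skewness. -/
theorem IsWave.sum_eq_zero (h : D.IsWave e ψ) : ∑ j, e j * (D.B *ᵥ ψ) j = 0 := by
  have hA : (cauchyMatrix D.w e)ᵀ = -cauchyMatrix D.w e := by
    ext j l; exact cauchyMatrix_skew _ _ _ _
  have h₁ := mulVec_dotProduct_self_of_skew hA (D.B *ᵥ ψ)
  have h₂ := mulVec_dotProduct_self_of_skew D.B_skew ψ
  have h₃ : ∑ j, e j * (D.B *ᵥ ψ) j = ∑ j, ψ j * (D.B *ᵥ ψ) j +
      ∑ j, (D.B *ᵥ ψ) j * (cauchyMatrix D.w e *ᵥ (D.B *ᵥ ψ)) j := by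
    rw [← Finset.sum_add_distrib]
    exact Finset.sum_congr rfl fun j _ => by rw [h.apply j]; ring
  rw [h₃, h₁, h₂, add_zero]

/-- Trades a sum quadratic in `ψ`, as produced by the constraint, for sums over `e_j (Bψ)_j`, as
produced by the Pfaffians. It is used with the weights `w²` and `1/(p² + w²)`. -/
theorem IsWave.sum_weight (h : D.IsWave e ψ) {g c : J → ℂ} {κ : ℂ}
    (hg : ∀ j l, g j - g l = κ * ((D.w j ^ 2 - D.w l ^ 2) * (c j * c l))) :
    ∑ j, g j * ψ j * (D.B *ᵥ ψ) j = ∑ j, g j * (e j * (D.B *ᵥ ψ) j) +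
      κ * ((∑ j, c j * (D.w j ^ 2 * (e j * (D.B *ᵥ ψ) j))) * (∑ j, c j * (e j * (D.B *ᵥ ψ) j)) -
        (∑ j, c j * (D.w j * (e j * (D.B *ᵥ ψ) j))) ^ 2) := by
  have h₁ := sum_weight_cauchyMatrix D.w_add_ne e (D.B *ᵥ ψ) hg
  have h₂ : ∑ j, g j * (e j * (D.B *ᵥ ψ) j) = ∑ j, g j * ψ j * (D.B *ᵥ ψ) j +
      ∑ j, g j * (D.B *ᵥ ψ) j * (cauchyMatrix D.w e *ᵥ (D.B *ᵥ ψ)) j := by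
    rw [← Finset.sum_add_distrib]
    refine Finset.sum_congr rfl fun j _ => ?_
    linear_combination (g j * (D.B *ᵥ ψ) j) * h.apply j
  rw [h₂, h₁]
  ring

theorem IsWave.sum_sq (h : D.IsWave e ψ) :
    ∑ j, D.w j ^ 2 * ψ j * (D.B *ᵥ ψ) j = ∑ j, D.w j ^ 2 * e j * (D.B *ᵥ ψ) j -
      (∑ j, D.w j * e j * (D.B *ᵥ ψ) j) ^ 2 := by
  have := h.sum_weight (g := fun j => D.w j ^ 2) (c := fun _ => 1) (κ := 1) (fun j l => by ring)
  simp only [one_mul, h.sum_eq_zero, ← mul_assoc] at this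
  rw [this]
  ring

theorem conj_mulVec_B (hψ : ∀ j, conj (ψ j) = ψ (D.τ j)) (j : J) :
    conj ((D.B *ᵥ ψ) j) = (D.B *ᵥ ψ) (D.τ j) := by
  simp only [mulVec, dotProduct, map_sum, map_mul, D.conj_B, hψ]
  exact Equiv.sum_comp D.τ fun l => D.B (D.τ j) l * ψ l

/-- The norm of a dark component relative to its background. -/
theorem IsWave.norm_dark (h : D.IsWave e ψ) (he : ∀ j, conj (e j) = e (D.τ j))
    (hψ : ∀ j, conj (ψ j) = ψ (D.τ j)) {n : ℕ} (hn : n ∈ D.dark) :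
    ((‖1 - ∑ j, (D.w j - Complex.I * D.p n) / (D.w j + Complex.I * D.p n) *
      (e j * (D.B *ᵥ ψ) j)‖ ^ 2 : ℝ) : ℂ) =
    1 + 4 * (D.p n : ℂ) ^ 2 * ∑ j, ((D.p n : ℂ) ^ 2 + D.w j ^ 2)⁻¹ * ψ j * (D.B *ᵥ ψ) j := by
  set p : ℂ := (D.p n : ℂ) with hp
  set P : J → ℂ := fun j => (p ^ 2 + D.w j ^ 2)⁻¹ with hP
  set x : J → ℂ := fun j => e j * (D.B *ᵥ ψ) j with hx
  have hpole : ∀ j, p ^ 2 + D.w j ^ 2 ≠ 0 := D.pole_ne n hn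
  have hPw : ∀ j, D.w j ^ 2 * P j = 1 - p ^ 2 * P j := fun j => by
    have := hpole j
    simp only [hP]; field_simp; ring
  have h₀ : ∑ j, x j = 0 := h.sum_eq_zero
  have hxτ : ∀ j, conj (x j) = x (D.τ j) := fun j => by
    simp only [hx, map_mul, he, conj_mulVec_B hψ]
  have hPτ : ∀ j, conj (P j) = P (D.τ j) := fun j => by
    simp [hP, hp, D.conj_w]
  set a := ∑ j, P j * x j with ha
  set b := ∑ j, P j * (D.w j * x j) with hb
  have hca : conj a = a := by
    simp only [ha, map_sum, map_mul, hxτ, hPτ]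
    exact Equiv.sum_comp D.τ fun l => P l * x l
  have hcb : conj b = b := by
    simp only [hb, map_sum, map_mul, hxτ, hPτ, D.conj_w]
    exact Equiv.sum_comp D.τ fun l => P l * (D.w l * x l)
  have hI : Complex.I ^ 2 = -1 := Complex.I_sq
  -- Since `a` and `b` are real, this separates real and imaginary parts; the squared norm is `(1 +
  -- 2p²a)² + 4p²b²`.
  have h₁ : 1 - ∑ j, (D.w j - Complex.I * p) / (D.w j + Complex.I * p) * x j =
      1 + 2 * p ^ 2 * a + 2 * Complex.I * p * b := by
    have : ∀ j, (D.w j - Complex.I * p) / (D.w j + Complex.I * p) * x j =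
        x j - 2 * p ^ 2 * (P j * x j) - 2 * Complex.I * p * (P j * (D.w j * x j)) := fun j => by
      have h₃ : p ^ 2 + D.w j ^ 2 = (D.w j + Complex.I * p) * (D.w j - Complex.I * p) := by
        linear_combination p ^ 2 * hI
      have h₄ := hpole j
      rw [h₃] at h₄
      have h₅ : (D.w j - Complex.I * p) / (D.w j + Complex.I * p) =
          (D.w j - Complex.I * p) ^ 2 * P j := by
        simp only [hP, h₃]
        have := left_ne_zero_of_mul h₄
        have := right_ne_zero_of_mul h₄
        field_simp
      rw [h₅]
      linear_combination x j * hPw j + x j * P j * p ^ 2 * hI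
    simp only [this, Finset.sum_sub_distrib, ← Finset.mul_sum, h₀, ← ha, ← hb]
    ring
  rw [h₁]
  have h₂ := h.sum_weight (g := P) (c := P) (κ := -1) (fun j l => by
    have := hpole j
    have := hpole l
    simp only [hP]; field_simp; ring)
  have h₃ : ∑ j, P j * (D.w j ^ 2 * x j) = -p ^ 2 * a := by
    have : ∀ j, P j * (D.w j ^ 2 * x j) = x j - p ^ 2 * (P j * x j) := fun j => by
      linear_combination x j * hPw j
    simp only [this, Finset.sum_sub_distrib, ← Finset.mul_sum, h₀, ← ha]
    ring
  have h₄ : ∑ j, P j * ψ j * (D.B *ᵥ ψ) j = a - (-p ^ 2 * a * a - b ^ 2) := by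
    rw [h₂, h₃]; ring
  rw [h₄, Complex.ofReal_pow, ← Complex.mul_conj']
  simp only [map_add, map_mul, map_one, map_pow, map_ofNat, hca, hcb, hp, Complex.conj_ofReal,
    Complex.conj_I]
  linear_combination (-4 * (D.p n : ℂ) ^ 2 * b ^ 2) * hI

theorem IsWave.norm_bright (hψ : ∀ j, conj (ψ j) = ψ (D.τ j)) (n : ℕ) :
    ((‖∑ j, D.β n j * ψ j‖ ^ 2 : ℝ) : ℂ) =
      (∑ j, D.β n j * ψ j) * ∑ j, conj (D.β n (D.τ j)) * ψ j := by
  rw [Complex.ofReal_pow, ← Complex.mul_conj']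
  congr 1
  simp only [map_sum, map_mul, hψ]
  rw [← Equiv.sum_comp D.τ]
  simp [D.τ_τ]

/-- The algebraic form of the second bilinear equation. -/
theorem IsWave.energy (h : D.IsWave e ψ) (he : ∀ j, conj (e j) = e (D.τ j))
    (hψ : ∀ j, conj (ψ j) = ψ (D.τ j)) :
    2 * (∑ j, D.w j ^ 2 * e j * (D.B *ᵥ ψ) j - (∑ j, D.w j * e j * (D.B *ᵥ ψ) j) ^ 2) +
      D.σ * ∑ n ∈ D.dark, (D.r n : ℂ) ^ 2 =
    D.σ * (∑ n ∈ D.bright, ((‖∑ j, D.β n j * ψ j‖ ^ 2 : ℝ) : ℂ) +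
      ∑ n ∈ D.dark, (D.r n : ℂ) ^ 2 *
        ((‖1 - ∑ j, (D.w j - Complex.I * D.p n) / (D.w j + Complex.I * D.p n) *
          (e j * (D.B *ᵥ ψ) j)‖ ^ 2 : ℝ) : ℂ)) := by
  rw [← h.sum_sq]
  have hσ : (D.σ : ℂ) ≠ 0 := by exact_mod_cast D.σ_ne
  -- The constraint multiplied by `ψ_j ψ_l` and summed. Its right side becomes twice the bright
  -- norms; its left side consists of weighted sums with weights `w²` and `1/(p_n² + w²)`, the
  -- latter being those in the dark norms.
  have h₁ : ∑ j, ∑ l, (2 / (D.σ : ℂ) * ((D.w j ^ 2 - D.w l ^ 2) * D.B j l) +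
    ∑ n ∈ D.dark, 4 * (D.p n : ℂ) ^ 2 * (D.r n : ℂ) ^ 2 *
      ((((D.p n : ℂ) ^ 2 + D.w l ^ 2)⁻¹ - ((D.p n : ℂ) ^ 2 + D.w j ^ 2)⁻¹) * D.B j l)) *
      (ψ j * ψ l) =
      ∑ j, ∑ l, (∑ n ∈ D.bright, (D.β n j * conj (D.β n (D.τ l)) +
        conj (D.β n (D.τ j)) * D.β n l)) * (ψ j * ψ l) := by
    simp only [D.constraint]
  have h₂ : ∑ j, ∑ l, (∑ n ∈ D.bright, (D.β n j * conj (D.β n (D.τ l)) +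
        conj (D.β n (D.τ j)) * D.β n l)) * (ψ j * ψ l) =
      2 * ∑ n ∈ D.bright, ((‖∑ j, D.β n j * ψ j‖ ^ 2 : ℝ) : ℂ) := by
    simp only [Finset.sum_mul, IsWave.norm_bright hψ]
    rw [sum_sum_sum_comm, Finset.mul_sum]
    refine Finset.sum_congr rfl fun n _ => ?_
    simpa only [← Finset.sum_mul] using
      sum_sum_symm_mul (D.β n) (fun j => conj (D.β n (D.τ j))) ψ
  have h₃ : ∑ j, ∑ l, (2 / (D.σ : ℂ) * ((D.w j ^ 2 - D.w l ^ 2) * D.B j l) +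
    ∑ n ∈ D.dark, 4 * (D.p n : ℂ) ^ 2 * (D.r n : ℂ) ^ 2 *
      ((((D.p n : ℂ) ^ 2 + D.w l ^ 2)⁻¹ - ((D.p n : ℂ) ^ 2 + D.w j ^ 2)⁻¹) * D.B j l)) *
      (ψ j * ψ l) =
      2 / (D.σ : ℂ) * (2 * ∑ j, D.w j ^ 2 * ψ j * (D.B *ᵥ ψ) j) -
      ∑ n ∈ D.dark, 4 * (D.p n : ℂ) ^ 2 * (D.r n : ℂ) ^ 2 *
        (2 * ∑ j, ((D.p n : ℂ) ^ 2 + D.w j ^ 2)⁻¹ * ψ j * (D.B *ᵥ ψ) j) := by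
    simp only [add_mul, Finset.sum_mul, Finset.sum_add_distrib]
    rw [sum_sum_sum_comm, sub_eq_add_neg, ← Finset.sum_neg_distrib]
    congr 1
    · rw [← sum_sub_mul_of_skew D.B_skew (fun j => D.w j ^ 2)]
      simp only [Finset.mul_sum]
      exact Finset.sum_congr rfl fun j _ => Finset.sum_congr rfl fun l _ => by ring
    · refine Finset.sum_congr rfl fun n _ => ?_
      rw [← sum_sub_mul_of_skew D.B_skew (fun j => ((D.p n : ℂ) ^ 2 + D.w j ^ 2)⁻¹)]
      simp only [Finset.mul_sum, ← Finset.sum_neg_distrib]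
      exact Finset.sum_congr rfl fun j _ => Finset.sum_congr rfl fun l _ => by ring
  have h₄ : ∑ n ∈ D.dark, (D.r n : ℂ) ^ 2 *
        ((‖1 - ∑ j, (D.w j - Complex.I * D.p n) / (D.w j + Complex.I * D.p n) *
          (e j * (D.B *ᵥ ψ) j)‖ ^ 2 : ℝ) : ℂ) = ∑ n ∈ D.dark, (D.r n : ℂ) ^ 2 +
      1 / 2 * ∑ n ∈ D.dark, 4 * (D.p n : ℂ) ^ 2 * (D.r n : ℂ) ^ 2 *
        (2 * ∑ j, ((D.p n : ℂ) ^ 2 + D.w j ^ 2)⁻¹ * ψ j * (D.B *ᵥ ψ) j) := by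
    rw [Finset.mul_sum, ← Finset.sum_add_distrib]
    refine Finset.sum_congr rfl fun n hn => ?_
    rw [h.norm_dark he hψ hn]
    ring
  rw [h₄]
  rw [h₃, h₂] at h₁
  have h₅ : 2 / (D.σ : ℂ) * D.σ = 2 := div_mul_cancel₀ _ hσ
  linear_combination (D.σ / 2 : ℂ) * h₁ - (∑ j, D.w j ^ 2 * ψ j * (D.B *ᵥ ψ) j) * h₅

end SolitonData

end SolitonAlgebra

/-! ### Pfaffians in terms of the wave function -/

section SolitonPfaffians

variable {J : Type*} [Fintype J] [DecidableEq J]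

namespace SolitonData

variable (D : SolitonData J) (e : J → ℂ)

/-- The array of Pfaffian entries of the symbols `a_j`, `b_j`. -/
noncomputable def form : Matrix (J ⊕ J) (J ⊕ J) ℂ :=
  Matrix.fromBlocks (cauchyMatrix D.w e) 1 (-1) D.B

/-- The entries of the symbol `d_l` with the symbols `a_j`, `b_j`. -/
noncomputable def dRow (l : ℤ) : J ⊕ J → ℂ := Sum.elim (fun j => D.w j ^ l * e j) 0

/-- The entries of the symbol `β_n` with the symbols `a_j`, `b_j`. -/
def brightRow (n : ℕ) : J ⊕ J → ℂ := Sum.elim 0 (-D.β n)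

/-- The entries of an additional symbol `a` with wave number `z` and amplitude `1`. -/
noncomputable def waveRow (z : ℂ) : J ⊕ J → ℂ :=
  Sum.elim (fun j => (D.w j - z) / (D.w j + z) * e j) 0

theorem form_skew : (D.form e)ᵀ = -D.form e := by
  have hA : (cauchyMatrix D.w e)ᵀ = -cauchyMatrix D.w e := by
    ext j l; exact cauchyMatrix_skew _ _ _ _
  simp [form, Matrix.fromBlocks_transpose, Matrix.fromBlocks_neg, hA, D.B_skew]

variable {e}

/-- Block elimination: the first block equation gives the second component of the solution, and
substitution in the other leaves a system with matrix `1 + AB` for the first component. -/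
theorem exists_vecMul_form (h : IsUnit (1 + cauchyMatrix D.w e * D.B)) (u : J ⊕ J → ℂ) :
    ∃ v, v ᵥ* D.form e = u := by
  have hdet := (Matrix.isUnit_iff_isUnit_det _).1 h
  set v := ((u ∘ Sum.inr) + (u ∘ Sum.inl) ᵥ* D.B) ᵥ* (1 + cauchyMatrix D.w e * D.B)⁻¹ with hv
  have h₁ : v + (v ᵥ* cauchyMatrix D.w e) ᵥ* D.B = (u ∘ Sum.inr) + (u ∘ Sum.inl) ᵥ* D.B := by
    rw [Matrix.vecMul_vecMul]
    have : v ᵥ* (1 + cauchyMatrix D.w e * D.B) = (u ∘ Sum.inr) + (u ∘ Sum.inl) ᵥ* D.B := by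
      rw [hv, Matrix.vecMul_vecMul, Matrix.nonsing_inv_mul _ hdet, Matrix.vecMul_one]
    rwa [Matrix.vecMul_add, Matrix.vecMul_one] at this
  refine ⟨Sum.elim v (v ᵥ* cauchyMatrix D.w e - u ∘ Sum.inl), ?_⟩
  rw [form, Matrix.vecMul_fromBlocks]
  ext (j | j)
  · simp [Matrix.vecMul_neg]
  · have := congrFun h₁ j
    simp only [Pi.add_apply, Function.comp_apply] at this
    simp only [Sum.elim_comp_inl, Sum.elim_comp_inr, Matrix.vecMul_one, Matrix.sub_vecMul,
      Sum.elim_inr, Pi.add_apply, Pi.sub_apply]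
    linear_combination this

theorem exists_isWave (h : IsUnit (1 + cauchyMatrix D.w e * D.B))
    (he : ∀ j, conj (e j) = e (D.τ j)) :
    ∃ ψ, D.IsWave e ψ ∧ ∀ j, conj (ψ j) = ψ (D.τ j) := by
  have hdet := (Matrix.isUnit_iff_isUnit_det _).1 h
  have hconj : ∀ j l, conj (cauchyMatrix D.w e j l) = cauchyMatrix D.w e (D.τ j) (D.τ l) :=
    fun j l => by simp [cauchyMatrix, D.conj_w, he]
  have hwave : ∀ ψ, D.IsWave e ψ ↔ (1 + cauchyMatrix D.w e * D.B) *ᵥ ψ = e := fun ψ => by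
    rw [IsWave, Matrix.add_mulVec, Matrix.one_mulVec, Matrix.mulVec_mulVec]
  have huniq : ∀ ψ φ, D.IsWave e ψ → D.IsWave e φ → ψ = φ := fun ψ φ hψ hφ => by
    rw [hwave] at hψ hφ
    exact Matrix.mulVec_injective_of_isUnit h (hψ.trans hφ.symm)
  obtain ⟨ψ, hψ⟩ : ∃ ψ, D.IsWave e ψ := by
    refine ⟨(1 + cauchyMatrix D.w e * D.B)⁻¹ *ᵥ e, ?_⟩
    rw [hwave, Matrix.mulVec_mulVec, Matrix.mul_nonsing_inv _ hdet, Matrix.one_mulVec]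
  refine ⟨ψ, hψ, ?_⟩
  -- The conjugated and reindexed `ψ` solves the same wave equation, so uniqueness gives the
  -- symmetry.
  have hsymm : D.IsWave e (fun j => conj (ψ (D.τ j))) := by
    have hB : ∀ j, (D.B *ᵥ fun j => conj (ψ (D.τ j))) j = conj ((D.B *ᵥ ψ) (D.τ j)) := fun j => by
      simp only [mulVec, dotProduct, map_sum, map_mul, D.conj_B, D.τ_τ]
      rw [← Equiv.sum_comp D.τ]
      simp [D.τ_τ]
    have hB' : (D.B *ᵥ fun j => conj (ψ (D.τ j))) = fun j => conj ((D.B *ᵥ ψ) (D.τ j)) :=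
      funext hB
    ext j
    have h₁ := congrArg conj (hψ.apply (D.τ j))
    rw [he, D.τ_τ, map_add] at h₁
    rw [h₁, hB', Pi.add_apply]
    congr 1
    simp only [mulVec, dotProduct, map_sum, map_mul, hconj, D.τ_τ]
    rw [← Equiv.sum_comp D.τ]
    simp [D.τ_τ]
  intro j
  conv_lhs => rw [huniq _ _ hψ hsymm]
  simp

theorem conj_form (he : ∀ j, conj (e j) = e (D.τ j)) (i i' : J ⊕ J) :
    conj (D.form e i i') = D.form e (Sum.map D.τ D.τ i) (Sum.map D.τ D.τ i') := by
  rcases i with j | j <;> rcases i' with l | l <;>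
    simp [form, cauchyMatrix, D.conj_w, he, D.conj_B, Matrix.one_apply, apply_ite conj]

theorem wick_form_real (he : ∀ j, conj (e j) = e (D.τ j)) {n : ℕ} {v : Fin n → J ⊕ J}
    (hv : mono (Sum.map D.τ D.τ ∘ v) = mono v) :
    conj (wick (D.form e) (mono v)) = wick (D.form e) (mono v) := by
  rw [conj_wick_mono (D.form_skew e) (D.conj_form he), hv]

/-- The second bilinear equation where the Pfaffian array is invertible. -/
theorem energy_of_isUnit (h : IsUnit (1 + cauchyMatrix D.w e * D.B))
    (he : ∀ j, conj (e j) = e (D.τ j)) {n : ℕ} {v : Fin n → J ⊕ J}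
    (hsurj : Function.Surjective v) (hv : mono (Sum.map D.τ D.τ ∘ v) = mono v) :
    2 * (wick (D.form e) (contr (D.dRow e 2) (contr (D.dRow e 0) (mono v))) *
        wick (D.form e) (mono v) -
      wick (D.form e) (contr (D.dRow e 1) (contr (D.dRow e 0) (mono v))) ^ 2) +
      D.σ * (∑ n ∈ D.dark, (D.r n : ℂ) ^ 2) * wick (D.form e) (mono v) ^ 2 =
    D.σ * (∑ n ∈ D.bright, ((‖wick (D.form e) (contr (D.dRow e 0)
        (contr (D.brightRow n) (mono v)))‖ ^ 2 : ℝ) : ℂ) +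
      ∑ n ∈ D.dark, (D.r n : ℂ) ^ 2 * ((‖wick (D.form e) (mono v) + wick (D.form e)
        (contr (D.dRow e 0) (contr (D.waveRow e (Complex.I * D.p n)) (mono v)))‖ ^ 2 : ℝ) : ℂ)) := by
  obtain ⟨ψ, hψ, hψτ⟩ := D.exists_isWave h he
  have hreal := D.wick_form_real he hv
  set f := wick (D.form e) (mono v) with hf
  have hsq : ((‖f‖ ^ 2 : ℝ) : ℂ) = f ^ 2 := by
    rw [Complex.ofReal_pow, ← Complex.mul_conj', hreal, sq]
  -- The wave equation says exactly that the row of `d_0` is represented by the form through this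
  -- vector. As the product has top degree, every Pfaffian `(d_0, u, •)` is then `f` times a dot
  -- product.
  have hd : Sum.elim (-(D.B *ᵥ ψ)) (-ψ) ᵥ* D.form e = D.dRow e 0 := by
    have hA : (cauchyMatrix D.w e)ᵀ = -cauchyMatrix D.w e := by
      ext j l; exact cauchyMatrix_skew _ _ _ _
    rw [form, Matrix.vecMul_fromBlocks]
    ext (j | j)
    · have := hψ.apply j
      rw [← Matrix.mulVec_transpose, hA]
      simp [dRow, this, Matrix.neg_mulVec, Matrix.mulVec_neg, Matrix.vecMul_neg, add_comm]
    · rw [← Matrix.mulVec_transpose D.B, D.B_skew]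
      simp [dRow, Matrix.neg_mulVec, Matrix.mulVec_neg]
  have hpair : ∀ u, wick (D.form e) (contr (D.dRow e 0) (contr u (mono v))) =
      (u ⬝ᵥ Sum.elim (-(D.B *ᵥ ψ)) (-ψ)) * f := fun u => by
    rw [← hd]
    exact wick_contr_contr_of_top (D.form_skew e) (ι_mul_mono_eq_zero hsurj) _ _
  have hk : ∀ l : ℤ, wick (D.form e) (contr (D.dRow e l) (contr (D.dRow e 0) (mono v))) =
      (∑ j, D.w j ^ l * e j * (D.B *ᵥ ψ) j) * f := fun l => by
    rw [contr_comm, map_neg, hpair]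
    simp [dRow, dotProduct]
  have hβ : ∀ n, wick (D.form e) (contr (D.dRow e 0) (contr (D.brightRow n) (mono v))) =
      (∑ j, D.β n j * ψ j) * f := fun n => by
    rw [hpair]
    simp [brightRow, dotProduct]
  have hγ : ∀ n, f + wick (D.form e) (contr (D.dRow e 0)
      (contr (D.waveRow e (Complex.I * D.p n)) (mono v))) =
      (1 - ∑ j, (D.w j - Complex.I * D.p n) / (D.w j + Complex.I * D.p n) *
          (e j * (D.B *ᵥ ψ) j)) * f := fun n => by
    rw [hpair]
    simp [waveRow, dotProduct, mul_assoc]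
    ring
  have henergy := hψ.energy he hψτ
  simp only [hk, hβ, hγ, norm_mul, mul_pow, Complex.ofReal_mul, hsq, ← mul_assoc,
    ← Finset.sum_mul]
  simp only [← mul_assoc] at henergy
  rw [← add_mul, ← mul_assoc, ← henergy]
  simp only [zpow_ofNat, pow_one]
  ring

end SolitonData

end SolitonPfaffians

/-! ### Removing the invertibility assumption -/

section SolitonPerturbation

open Filter Topology

variable {J : Type*} [Fintype J] [DecidableEq J]

namespace SolitonData

variable (D : SolitonData J)

section Smooth

variable {E : Type*} [NormedAddCommGroup E] [NormedSpace ℝ E] {k : WithTop ℕ∞} {e : E → J → ℂ}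

theorem contDiff_form (he : ∀ j, ContDiff ℝ k fun x => e x j) (i i' : J ⊕ J) :
    ContDiff ℝ k fun x => D.form (e x) i i' := by
  rcases i with j | j <;> rcases i' with l | l
  · exact contDiff_const.mul ((he j).mul (he l))
  all_goals exact contDiff_const

omit [DecidableEq J] in
theorem contDiff_dRow (he : ∀ j, ContDiff ℝ k fun x => e x j) (l : ℤ) (i : J ⊕ J) :
    ContDiff ℝ k fun x => D.dRow (e x) l i := by
  rcases i with j | j
  · exact contDiff_const.mul (he j)
  · exact contDiff_const

omit [DecidableEq J] in
theorem contDiff_waveRow (he : ∀ j, ContDiff ℝ k fun x => e x j) (z : ℂ) (i : J ⊕ J) :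
    ContDiff ℝ k fun x => D.waveRow (e x) z i := by
  rcases i with j | j
  · exact contDiff_const.mul (he j)
  · exact contDiff_const

end Smooth

variable (e : J → ℂ)

/-- The determinant is a polynomial in `a` with value `1` at `a = 0`, hence has finitely many roots.
-/
theorem finite_not_isUnit_one_add_sq_smul (M : Matrix J J ℂ) :
    {a : ℝ | ¬ IsUnit (1 + (a : ℂ) ^ 2 • M)}.Finite := by
  set P : Polynomial ℂ := (1 + (Polynomial.X : Polynomial ℂ) ^ 2 • M.map Polynomial.C).det with hP
  have heval : ∀ a : ℂ, P.eval a = (1 + a ^ 2 • M).det := fun a => by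
    rw [hP, ← Polynomial.coe_evalRingHom, RingHom.map_det]
    congr 1
    ext i j
    simp [Matrix.one_apply, apply_ite (Polynomial.eval a), mul_comm (M i j)]
  have hne : P ≠ 0 := fun h => by
    have := heval 0
    simp [h] at this
  refine ((P.rootSet_finite ℂ).preimage Complex.ofReal_injective.injOn).subset fun a ha => ?_
  rw [Set.mem_ofPred_eq, Matrix.isUnit_iff_isUnit_det, isUnit_iff_ne_zero, not_not, ← heval] at ha
  simpa [Polynomial.mem_rootSet, hne] using ha

omit [Fintype J] [DecidableEq J] in
theorem cauchyMatrix_smul (w e : J → ℂ) (c : ℂ) :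
    cauchyMatrix w (c • e) = c ^ 2 • cauchyMatrix w e := by
  ext j l
  simp [cauchyMatrix]
  ring

theorem eventually_isUnit :
    ∀ᶠ a : ℝ in 𝓝[≠] 1, IsUnit (1 + cauchyMatrix D.w ((a : ℂ) • e) * D.B) := by
  have h := finite_not_isUnit_one_add_sq_smul (cauchyMatrix D.w e * D.B)
  -- The point `1` may itself be singular; with it removed, the finite exceptional set is closed and
  -- misses `1`.
  have h₁ : ∀ᶠ a : ℝ in 𝓝[≠] 1, a ∉ {a : ℝ | ¬ IsUnit (1 + (a : ℂ) ^ 2 •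
      (cauchyMatrix D.w e * D.B))} \ {1} :=
    mem_nhdsWithin_of_mem_nhds ((h.subset Set.sdiff_subset).isClosed.isOpen_compl.mem_nhds (by simp))
  filter_upwards [h₁, self_mem_nhdsWithin] with a ha ha₁
  rw [cauchyMatrix_smul, Matrix.smul_mul]
  by_contra hcon
  exact ha ⟨hcon, ha₁⟩

/-- An identity between continuous functions of the amplitude holds if it holds where the
Pfaffian array is invertible. -/
theorem eq_of_isUnit {F G : (J → ℂ) → ℂ} (hF : Continuous fun a : ℝ => F ((a : ℂ) • e))
    (hG : Continuous fun a : ℝ => G ((a : ℂ) • e))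
    (h : ∀ a : ℝ, IsUnit (1 + cauchyMatrix D.w ((a : ℂ) • e) * D.B) →
      F ((a : ℂ) • e) = G ((a : ℂ) • e)) : F e = G e := by
  have h₁ : Tendsto (fun a : ℝ => F ((a : ℂ) • e)) (𝓝[≠] 1) (𝓝 (F e)) := by
    simpa using (hF.tendsto 1).mono_left nhdsWithin_le_nhds
  have h₂ : Tendsto (fun a : ℝ => G ((a : ℂ) • e)) (𝓝[≠] 1) (𝓝 (G e)) := by
    simpa using (hG.tendsto 1).mono_left nhdsWithin_le_nhds
  exact tendsto_nhds_unique_of_eventuallyEq h₁ h₂ ((D.eventually_isUnit e).mono h)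

omit [Fintype J] [DecidableEq J] in
theorem contDiff_amplitude (j : J) :
    ContDiff ℝ 0 fun a : ℝ => ((a : ℂ) • e) j := by
  simp only [Pi.smul_apply, smul_eq_mul]
  exact (Complex.ofRealCLM.contDiff).mul contDiff_const

theorem continuous_wick_amplitude (X : ExteriorAlgebra ℂ (J ⊕ J → ℂ)) :
    Continuous fun a : ℝ => wick (D.form ((a : ℂ) • e)) X :=
  (contDiff_wick (fun _ => D.form_skew _) (D.contDiff_form (contDiff_amplitude e)) X).continuous

theorem plucker {X : ExteriorAlgebra ℂ (J ⊕ J → ℂ)} (hX : ∀ v, ExteriorAlgebra.ι ℂ v * X = 0)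
    (u a b c : J ⊕ J → ℂ) :
    wick (D.form e) (contr u (contr a (contr b (contr c X)))) * wick (D.form e) X =
      wick (D.form e) (contr u (contr a X)) * wick (D.form e) (contr b (contr c X)) -
      wick (D.form e) (contr u (contr b X)) * wick (D.form e) (contr a (contr c X)) +
      wick (D.form e) (contr u (contr c X)) * wick (D.form e) (contr a (contr b X)) := by
  have hc := D.continuous_wick_amplitude e
  refine D.eq_of_isUnit e
    (F := fun e => wick (D.form e) (contr u (contr a (contr b (contr c X)))) * wick (D.form e) X)
    (G := fun e => wick (D.form e) (contr u (contr a X)) * wick (D.form e) (contr b (contr c X)) -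
      wick (D.form e) (contr u (contr b X)) * wick (D.form e) (contr a (contr c X)) +
      wick (D.form e) (contr u (contr c X)) * wick (D.form e) (contr a (contr b X)))
    ((hc _).mul (hc _)) ((((hc _).mul (hc _)).sub ((hc _).mul (hc _))).add ((hc _).mul (hc _)))
    fun s hs => ?_
  exact wick_plucker (D.form_skew _) hX (D.exists_vecMul_form hs) u a b c

theorem energy_eq_of_isUnit {f f₁ f₂ : (J → ℂ) → ℂ} {b d : ℕ → (J → ℂ) → ℂ}
    (hf : Continuous fun a : ℝ => f ((a : ℂ) • e)) (hf₁ : Continuous fun a : ℝ => f₁ ((a : ℂ) • e))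
    (hf₂ : Continuous fun a : ℝ => f₂ ((a : ℂ) • e))
    (hb : ∀ n, Continuous fun a : ℝ => b n ((a : ℂ) • e))
    (hd : ∀ n, Continuous fun a : ℝ => d n ((a : ℂ) • e))
    (h : ∀ a : ℝ, IsUnit (1 + cauchyMatrix D.w ((a : ℂ) • e) * D.B) →
      2 * (f₂ ((a : ℂ) • e) * f ((a : ℂ) • e) - f₁ ((a : ℂ) • e) ^ 2) +
        D.σ * (∑ n ∈ D.dark, (D.r n : ℂ) ^ 2) * f ((a : ℂ) • e) ^ 2 =
      D.σ * (∑ n ∈ D.bright, ((‖b n ((a : ℂ) • e)‖ ^ 2 : ℝ) : ℂ) + ∑ n ∈ D.dark,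
        (D.r n : ℂ) ^ 2 * ((‖f ((a : ℂ) • e) + d n ((a : ℂ) • e)‖ ^ 2 : ℝ) : ℂ))) :
    2 * (f₂ e * f e - f₁ e ^ 2) + D.σ * (∑ n ∈ D.dark, (D.r n : ℂ) ^ 2) * f e ^ 2 =
      D.σ * (∑ n ∈ D.bright, ((‖b n e‖ ^ 2 : ℝ) : ℂ) + ∑ n ∈ D.dark,
        (D.r n : ℂ) ^ 2 * ((‖f e + d n e‖ ^ 2 : ℝ) : ℂ)) := by
  refine D.eq_of_isUnit e
    (F := fun e => 2 * (f₂ e * f e - f₁ e ^ 2) +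
      D.σ * (∑ n ∈ D.dark, (D.r n : ℂ) ^ 2) * f e ^ 2)
    (G := fun e => D.σ * (∑ n ∈ D.bright, ((‖b n e‖ ^ 2 : ℝ) : ℂ) + ∑ n ∈ D.dark,
      (D.r n : ℂ) ^ 2 * ((‖f e + d n e‖ ^ 2 : ℝ) : ℂ))) ?_ ?_ h
  · exact (continuous_const.mul ((hf₂.mul hf).sub (hf₁.pow 2))).add
      (continuous_const.mul (hf.pow 2))
  · exact continuous_const.mul (.add
      (continuous_finsetSum _ fun n _ => Complex.continuous_ofReal.comp ((hb n).norm.pow 2))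
      (continuous_finsetSum _ fun n _ => continuous_const.mul
        (Complex.continuous_ofReal.comp ((hf.add (hd n)).norm.pow 2))))

/-- The second bilinear equation, in terms of Pfaffians. -/
theorem energy (he : ∀ j, conj (e j) = e (D.τ j)) {n : ℕ} {v : Fin n → J ⊕ J}
    (hsurj : Function.Surjective v) (hv : mono (Sum.map D.τ D.τ ∘ v) = mono v) :
    2 * (wick (D.form e) (contr (D.dRow e 2) (contr (D.dRow e 0) (mono v))) *
        wick (D.form e) (mono v) -
      wick (D.form e) (contr (D.dRow e 1) (contr (D.dRow e 0) (mono v))) ^ 2) +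
      D.σ * (∑ n ∈ D.dark, (D.r n : ℂ) ^ 2) * wick (D.form e) (mono v) ^ 2 =
    D.σ * (∑ n ∈ D.bright, ((‖wick (D.form e) (contr (D.dRow e 0)
        (contr (D.brightRow n) (mono v)))‖ ^ 2 : ℝ) : ℂ) +
      ∑ n ∈ D.dark, (D.r n : ℂ) ^ 2 * ((‖wick (D.form e) (mono v) + wick (D.form e)
        (contr (D.dRow e 0) (contr (D.waveRow e (Complex.I * D.p n)) (mono v)))‖ ^ 2 : ℝ) : ℂ)) := by
  have he' := contDiff_amplitude e
  have hc := D.continuous_wick_amplitude e (mono v)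
  have hcc : ∀ {δ ε : ℝ → J ⊕ J → ℂ} (_ : ∀ i, ContDiff ℝ 0 fun a => δ a i)
      (_ : ∀ i, ContDiff ℝ 0 fun a => ε a i),
      Continuous fun a : ℝ => wick (D.form ((a : ℂ) • e)) (contr (δ a) (contr (ε a) (mono v))) :=
    fun hδ hε => (contDiff_wick_contr_contr (fun _ => D.form_skew _) (D.contDiff_form he')
      hδ hε _).continuous
  have hd := fun l => D.contDiff_dRow he' l
  have h₂ := hcc (hd 2) (hd 0)
  have h₁ := hcc (hd 1) (hd 0)
  have hβ := fun n => hcc (hd 0) (ε := fun _ => D.brightRow n) fun i => contDiff_const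
  have hγ := fun n => hcc (hd 0) (D.contDiff_waveRow he' (Complex.I * D.p n))
  exact D.energy_eq_of_isUnit e (f := fun e => wick (D.form e) (mono v))
    (f₁ := fun e => wick (D.form e) (contr (D.dRow e 1) (contr (D.dRow e 0) (mono v))))
    (f₂ := fun e => wick (D.form e) (contr (D.dRow e 2) (contr (D.dRow e 0) (mono v))))
    (b := fun n e => wick (D.form e) (contr (D.dRow e 0) (contr (D.brightRow n) (mono v))))
    (d := fun n e => wick (D.form e)
      (contr (D.dRow e 0) (contr (D.waveRow e (Complex.I * D.p n)) (mono v))))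
    -- The scaling factor is real, so the scaled amplitudes keep their conjugation symmetry.
    hc h₁ h₂ hβ hγ fun a ha => D.energy_of_isUnit ha (fun j => by simp [he]) hsurj hv

end SolitonData

end SolitonPerturbation

/-! ### Hirota derivatives in terms of ordinary derivatives -/

section Hirota

theorem hirotaD_one_one {F Fx Ft Fxt G Gx Gt Gxt : ℝ → ℝ → ℂ}
    (hFx : ∀ x t, HasDerivAt (fun x => F x t) (Fx x t) x)
    (hFt : ∀ x t, HasDerivAt (fun t => F x t) (Ft x t) t)
    (hFxt : ∀ x t, HasDerivAt (fun x => Ft x t) (Fxt x t) x)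
    (hGx : ∀ x t, HasDerivAt (fun x => G x t) (Gx x t) x)
    (hGt : ∀ x t, HasDerivAt (fun t => G x t) (Gt x t) t)
    (hGxt : ∀ x t, HasDerivAt (fun x => Gt x t) (Gxt x t) x) (x t : ℝ) :
    hirotaD 1 1 F G x t = Fxt x t * G x t - Ft x t * Gx x t - Fx x t * Gt x t + F x t * Gxt x t := by
  have hadd : ∀ {f : ℝ → ℂ} {f' : ℂ} {y : ℝ}, HasDerivAt f f' y →
      HasDerivAt (fun s => f (y + s)) f' 0 := fun {f f' y} h => by
    simpa using HasDerivAt.comp_const_add y 0 (by simpa using h)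
  have hsub : ∀ {f : ℝ → ℂ} {f' : ℂ} {y : ℝ}, HasDerivAt f f' y →
      HasDerivAt (fun s => f (y - s)) (-f') 0 := fun {f f' y} h => by
    simpa using HasDerivAt.comp_const_sub y 0 (by simpa using h)
  simp only [hirotaD, iteratedDeriv_one]
  have inner : ∀ ε : ℝ, deriv (fun δ : ℝ => F (x + ε) (t + δ) * G (x - ε) (t - δ)) 0 =
      Ft (x + ε) t * G (x - ε) t - F (x + ε) t * Gt (x - ε) t := fun ε => by
    have := (hadd (hFt (x + ε) t)).fun_mul (hsub (hGt (x - ε) t))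
    rw [this.deriv]
    simp
    ring
  simp only [inner]
  have := ((hadd (hFxt x t)).fun_mul (hsub (hGx x t))).fun_sub
    ((hadd (hFx x t)).fun_mul (hsub (hGxt x t)))
  rw [this.deriv]
  simp
  ring

theorem hirotaD_two_zero {F Fx Fxx : ℝ → ℝ → ℂ}
    (hFx : ∀ x t, HasDerivAt (fun x => F x t) (Fx x t) x)
    (hFxx : ∀ x t, HasDerivAt (fun x => Fx x t) (Fxx x t) x) (x t : ℝ) :
    hirotaD 2 0 F F x t = 2 * (Fxx x t * F x t - Fx x t ^ 2) := by
  have hadd : ∀ {f f' : ℝ → ℂ} (s : ℝ), (∀ y, HasDerivAt f (f' y) y) →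
      HasDerivAt (fun s => f (x + s)) (f' (x + s)) s := fun s h =>
    HasDerivAt.comp_const_add x s (h _)
  have hsub : ∀ {f f' : ℝ → ℂ} (s : ℝ), (∀ y, HasDerivAt f (f' y) y) →
      HasDerivAt (fun s => f (x - s)) (-f' (x - s)) s := fun s h =>
    HasDerivAt.comp_const_sub x s (h _)
  simp only [hirotaD, iteratedDeriv_zero, add_zero, sub_zero]
  rw [iteratedDeriv_succ, iteratedDeriv_one]
  have h₁ : ∀ s, HasDerivAt (fun s : ℝ => F (x + s) t * F (x - s) t)
      (Fx (x + s) t * F (x - s) t - F (x + s) t * Fx (x - s) t) s := fun s => by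
    have := (hadd s fun y => hFx y t).fun_mul (hsub s fun y => hFx y t)
    exact this.congr_deriv (by ring)
  rw [funext fun s => (h₁ s).deriv]
  have := ((hadd 0 fun y => hFxx y t).fun_mul (hsub 0 fun y => hFx y t)).fun_sub
    ((hadd 0 fun y => hFx y t).fun_mul (hsub 0 fun y => hFxx y t))
  rw [this.deriv]
  simp
  ring

end Hirota

/-! ### Evolution in space and time, and the first bilinear equation -/

section SolitonDynamics

variable {J : Type*} [Fintype J] [DecidableEq J]

namespace SolitonData

variable (D : SolitonData J) {e : ℝ → ℝ → J → ℂ} {c : ℂ}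

omit [DecidableEq J] in
theorem w_ne (j : J) : D.w j ≠ 0 := fun h => D.w_add_ne j j (by rw [h, add_zero])

section Space

variable (hx : ∀ x t j, HasDerivAt (fun x => e x t j) (D.w j * e x t j) x)
include hx

omit [DecidableEq J] in
theorem hasDerivAt_dRow_space (x t : ℝ) (l : ℤ) (i : J ⊕ J) :
    HasDerivAt (fun x => D.dRow (e x t) l i) (D.dRow (e x t) (l + 1) i) x := by
  rcases i with j | j
  · refine ((hx x t j).const_mul (D.w j ^ l)).congr_deriv ?_
    simp only [dRow, Sum.elim_inl, zpow_add₀ (D.w_ne j), zpow_one]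
    ring
  · exact hasDerivAt_const _ _

/-- Differentiating `e_j e_l` gives the factor `w_j + w_l`, which cancels the Cauchy denominator;
the numerator `w_l - w_j` left over has rank two. -/
theorem hasDerivAt_form_space (x t : ℝ) (i i' : J ⊕ J) :
    HasDerivAt (fun x => D.form (e x t) i i')
      (D.dRow (e x t) 0 i * D.dRow (e x t) 1 i' - D.dRow (e x t) 1 i * D.dRow (e x t) 0 i') x := by
  rcases i with j | j <;> rcases i' with l | l
  · refine (((hx x t j).mul (hx x t l)).const_mul ((D.w l - D.w j) / (D.w l + D.w j))).congr_deriv ?_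
    have := D.w_add_ne l j
    simp only [dRow, Sum.elim_inl, zpow_zero, zpow_one]
    field_simp
    ring
  all_goals
    refine (hasDerivAt_const _ _).congr_deriv ?_
    simp [dRow]

end Space

section Time

variable (ht : ∀ x t j, HasDerivAt (fun t => e x t j) (c / D.w j * e x t j) t)
include ht

omit [DecidableEq J] in
theorem hasDerivAt_dRow_time (x t : ℝ) (l : ℤ) (i : J ⊕ J) :
    HasDerivAt (fun t => D.dRow (e x t) l i) ((c • D.dRow (e x t) (l - 1)) i) t := by
  rcases i with j | j
  · refine ((ht x t j).const_mul (D.w j ^ l)).congr_deriv ?_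
    simp only [dRow, Sum.elim_inl, Pi.smul_apply, smul_eq_mul, zpow_sub₀ (D.w_ne j), zpow_one]
    ring
  · refine (hasDerivAt_const _ _).congr_deriv ?_
    simp [dRow]

/-- Here the factor is `c (w_j + w_l) / (w_j w_l)`, so what is left is `c (1/w_j - 1/w_l) e_j e_l`,
again of rank two. -/
theorem hasDerivAt_form_time (x t : ℝ) (i i' : J ⊕ J) :
    HasDerivAt (fun t => D.form (e x t) i i')
      ((c • D.dRow (e x t) (-1)) i * D.dRow (e x t) 0 i' -
        D.dRow (e x t) 0 i * (c • D.dRow (e x t) (-1)) i') t := by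
  rcases i with j | j <;> rcases i' with l | l
  · refine (((ht x t j).mul (ht x t l)).const_mul ((D.w l - D.w j) / (D.w l + D.w j))).congr_deriv ?_
    have := D.w_add_ne l j
    have := D.w_ne j
    have := D.w_ne l
    simp only [dRow, Sum.elim_inl, zpow_zero, _root_.zpow_neg_one, Pi.smul_apply, smul_eq_mul]
    field_simp
  all_goals
    refine (hasDerivAt_const _ _).congr_deriv ?_
    simp [dRow]

end Time

variable (hx : ∀ x t j, HasDerivAt (fun x => e x t j) (D.w j * e x t j) x)
  (ht : ∀ x t j, HasDerivAt (fun t => e x t j) (c / D.w j * e x t j) t)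
include hx

theorem hasDerivAt_wick_space (X : ExteriorAlgebra ℂ (J ⊕ J → ℂ)) (x t : ℝ) :
    HasDerivAt (fun x => wick (D.form (e x t)) X)
      (wick (D.form (e x t)) (contr (D.dRow (e x t) 1) (contr (D.dRow (e x t) 0) X))) x :=
  hasDerivAt_wick (fun _ => D.form_skew _) (D.hasDerivAt_form_space hx x t) X

theorem hirotaD_tau (X : ExteriorAlgebra ℂ (J ⊕ J → ℂ)) (x t : ℝ) :
    hirotaD 2 0 (fun x t => wick (D.form (e x t)) X) (fun x t => wick (D.form (e x t)) X) x t =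
      2 * (wick (D.form (e x t)) (contr (D.dRow (e x t) 2) (contr (D.dRow (e x t) 0) X)) *
        wick (D.form (e x t)) X -
        wick (D.form (e x t)) (contr (D.dRow (e x t) 1) (contr (D.dRow (e x t) 0) X)) ^ 2) := by
  refine hirotaD_two_zero (D.hasDerivAt_wick_space hx X) (Fxx := fun x t =>
    wick (D.form (e x t)) (contr (D.dRow (e x t) 2) (contr (D.dRow (e x t) 0) X)))
    (fun x t => ?_) x t
  refine (hasDerivAt_wick_contr_contr (fun _ => D.form_skew _) (D.hasDerivAt_form_space hx x t)
    (D.hasDerivAt_dRow_space hx x t 1) (D.hasDerivAt_dRow_space hx x t 0) X).congr_deriv ?_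
  -- All terms but `(d_2, d_0, •)` contain a repeated row.
  rw [contr_comm (D.dRow (e x t) 0) (D.dRow (e x t) 1), map_neg, contr_self]
  simp [contr_self]

include ht

/-- The first bilinear equation for a component given by an additional symbol. -/
theorem hirotaD_component {X : ExteriorAlgebra ℂ (J ⊕ J → ℂ)}
    (hX : ∀ v, ExteriorAlgebra.ι ℂ v * X = 0) {h : ℝ → ℝ → ℂ} {ζ : ℝ → ℝ → J ⊕ J → ℂ} {z : ℂ}
    (hz : z ≠ 0) (hhx : ∀ x t, HasDerivAt (fun x => h x t) (z * h x t) x)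
    (hht : ∀ x t, HasDerivAt (fun t => h x t) (c / z * h x t) t)
    (hζx : ∀ x t i, HasDerivAt (fun x => ζ x t i)
      ((h x t • D.dRow (e x t) 1 - (z * h x t) • D.dRow (e x t) 0) i) x)
    (hζt : ∀ x t i, HasDerivAt (fun t => ζ x t i)
      ((c • ((h x t / z) • D.dRow (e x t) 0 - h x t • D.dRow (e x t) (-1))) i) t) (x t : ℝ) :
    hirotaD 1 1 (fun x t => h x t * wick (D.form (e x t)) X +
        wick (D.form (e x t)) (contr (D.dRow (e x t) 0) (contr (ζ x t) X)))
      (fun x t => wick (D.form (e x t)) X) x t =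
    c * ((h x t * wick (D.form (e x t)) X +
        wick (D.form (e x t)) (contr (D.dRow (e x t) 0) (contr (ζ x t) X))) *
      wick (D.form (e x t)) X) := by
  set W : ℝ → ℝ → ExteriorAlgebra ℂ (J ⊕ J → ℂ) →ₗ[ℂ] ℂ := fun x t => wick (D.form (e x t)) with hW
  set d : ℤ → ℝ → ℝ → J ⊕ J → ℂ := fun l x t => D.dRow (e x t) l with hd
  have hWx := D.hasDerivAt_wick_space hx X
  have hWt : ∀ x t, HasDerivAt (fun t => W x t X)
      (c * W x t (contr (d 0 x t) (contr (d (-1) x t) X))) t := fun x t => by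
    refine (hasDerivAt_wick (fun _ => D.form_skew _)
      (D.hasDerivAt_form_time ht x t) X).congr_deriv ?_
    simp [contr_smul, hW, hd]
  have hWxt : ∀ x t, HasDerivAt (fun x => c * W x t (contr (d 0 x t) (contr (d (-1) x t) X)))
      (c * W x t (contr (d 1 x t) (contr (d (-1) x t) X))) x := fun x t => by
    refine ((hasDerivAt_wick_contr_contr (fun _ => D.form_skew _) (D.hasDerivAt_form_space hx x t)
      (D.hasDerivAt_dRow_space hx x t 0) (D.hasDerivAt_dRow_space hx x t (-1)) X).const_mul
      c).congr_deriv ?_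
    simp [contr_self, hW, hd]
  have hgx : ∀ x t, HasDerivAt (fun x => h x t * W x t X +
        W x t (contr (d 0 x t) (contr (ζ x t) X)))
      (z * h x t * W x t X + W x t (contr (d 1 x t) (contr (ζ x t) X))) x := fun x t => by
    refine (((hhx x t).mul (hWx x t)).add (hasDerivAt_wick_contr_contr (fun _ => D.form_skew _)
      (D.hasDerivAt_form_space hx x t) (D.hasDerivAt_dRow_space hx x t 0) (hζx x t)
      X)).congr_deriv ?_
    simp only [contr_self, contr_sub, contr_smul, map_sub, map_smul, map_zero, smul_eq_mul, hW, hd]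
    rw [contr_comm (D.dRow (e x t) 1) (D.dRow (e x t) 0), map_neg]
    simp
    ring
  have hgt : ∀ x t, HasDerivAt (fun t => h x t * W x t X +
        W x t (contr (d 0 x t) (contr (ζ x t) X)))
      (c * (h x t / z * W x t X + W x t (contr (d (-1) x t) (contr (ζ x t) X)))) t := fun x t => by
    refine (((hht x t).mul (hWt x t)).add (hasDerivAt_wick_contr_contr (fun _ => D.form_skew _)
      (D.hasDerivAt_form_time ht x t) (D.hasDerivAt_dRow_time ht x t 0) (hζt x t)
      X)).congr_deriv ?_
    rw [contr_comm (c • D.dRow (e x t) (-1)) (D.dRow (e x t) 0), map_neg, contr_self]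
    simp only [contr_self, contr_sub, contr_smul, map_sub, map_smul, map_zero, smul_eq_mul, hW, hd]
    simp
    ring
  have hgxt : ∀ x t, HasDerivAt (fun x => c * (h x t / z * W x t X +
        W x t (contr (d (-1) x t) (contr (ζ x t) X))))
      (c * (h x t * W x t X + h x t / z * W x t (contr (d 1 x t) (contr (d 0 x t) X)) +
        W x t (contr (d 0 x t) (contr (ζ x t) X)) + h x t * W x t (contr (d (-1) x t)
          (contr (d 1 x t) X)) - z * h x t * W x t (contr (d (-1) x t) (contr (d 0 x t) X)) +
        W x t (contr (d 1 x t) (contr (d 0 x t) (contr (d (-1) x t) (contr (ζ x t) X)))))) x :=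
      fun x t => by
    refine (((((hhx x t).div_const z).mul (hWx x t)).add (hasDerivAt_wick_contr_contr
      (fun _ => D.form_skew _) (D.hasDerivAt_form_space hx x t)
      (D.hasDerivAt_dRow_space hx x t (-1)) (hζx x t) X)).const_mul c).congr_deriv ?_
    simp only [contr_sub, contr_smul, map_sub, map_smul, smul_eq_mul, hW, hd]
    rw [mul_div_cancel_left₀ _ hz]
    simp only [neg_add_cancel]
    ring
  rw [hirotaD_one_one hgx hgt hgxt hWx hWt hWxt]
  -- The terms carrying `h` cancel against each other and the right side; the rest of the bilinear
  -- equation is `c` times this Plücker relation.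
  have hP := D.plucker (e x t) hX (d 1 x t) (d 0 x t) (d (-1) x t) (ζ x t)
  have h₁ : ∀ k l, W x t (contr (d k x t) (contr (d l x t) X)) =
      -W x t (contr (d l x t) (contr (d k x t) X)) := fun k l => by rw [contr_comm, map_neg]
  have h₂ := h₁ (-1) 1
  have h₃ := h₁ (-1) 0
  simp only [hW, hd] at hP h₂ h₃ ⊢
  rw [h₂, h₃]
  linear_combination c * hP

end SolitonData

end SolitonDynamics

/-! ### Invariance of the full product under permutations of the solitons -/

section PairedProducts

variable {J : Type*} [DecidableEq J]

theorem mono_eq_prod {ι : Type*} [DecidableEq ι] {n : ℕ} (v : Fin n → ι) :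
    mono v = ((List.ofFn v).map fun i => ExteriorAlgebra.ι ℂ (Pi.single i (1 : ℂ))).prod := by
  rw [mono, ιMulti_apply, List.map_ofFn]
  rfl

/-- The product of the pairs `a_j b_j` along a list. -/
noncomputable def pairProd (l : List J) : ExteriorAlgebra ℂ (J ⊕ J → ℂ) :=
  (l.map fun j => ExteriorAlgebra.ι ℂ (Pi.single (Sum.inl j) (1 : ℂ) : J ⊕ J → ℂ) *
    ExteriorAlgebra.ι ℂ (Pi.single (Sum.inr j) (1 : ℂ))).prod

theorem commute_ι_mul_ι {V : Type*} [AddCommGroup V] [Module ℂ V] (a b c : V) :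
    Commute (ExteriorAlgebra.ι ℂ a * ExteriorAlgebra.ι ℂ b) (ExteriorAlgebra.ι ℂ c) := by
  have h₁ := eq_neg_of_add_eq_zero_left (ExteriorAlgebra.ι_add_mul_swap (R := ℂ) b c)
  have h₂ := eq_neg_of_add_eq_zero_left (ExteriorAlgebra.ι_add_mul_swap (R := ℂ) a c)
  rw [Commute, SemiconjBy, mul_assoc, h₁, mul_neg, ← mul_assoc, h₂, neg_mul, neg_neg, mul_assoc]

theorem commute_pairProd (l : List J) (c : J ⊕ J → ℂ) :
    Commute (pairProd l) (ExteriorAlgebra.ι ℂ c) := by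
  refine (Commute.list_prod_right _ _ fun x hx => ?_).symm
  obtain ⟨j, _, rfl⟩ := List.mem_map.1 hx
  exact (commute_ι_mul_ι _ _ _).symm

/-- The nested order lets each `b_j` move inward past complete pairs, which are even and hence
commute with everything, so no sign appears. -/
theorem prod_append_reverse_eq_pairProd (l : List J) :
    ((l.map Sum.inl ++ l.reverse.map Sum.inr : List (J ⊕ J)).map
      fun i => ExteriorAlgebra.ι ℂ (Pi.single i (1 : ℂ))).prod = pairProd l := by
  induction l with
  | nil => simp [pairProd]
  | cons j l ih =>
    have h : pairProd (j :: l) = ExteriorAlgebra.ι ℂ (Pi.single (Sum.inl j) (1 : ℂ)) *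
        ExteriorAlgebra.ι ℂ (Pi.single (Sum.inr j) (1 : ℂ)) * pairProd l := by
      simp [pairProd]
    rw [h, mul_assoc, ← (commute_pairProd l _).eq, ← ih]
    simp [mul_assoc]

theorem pairProd_perm {l l' : List J} (h : l.Perm l') : pairProd l = pairProd l' := by
  refine List.Perm.prod_eq' (h.map _) ?_
  rw [List.pairwise_map]
  exact List.pairwise_of_forall fun i j =>
    (commute_ι_mul_ι _ _ _).mul_right (commute_ι_mul_ι _ _ _)

variable {n : ℕ}

/-- The symbols `a_1, …, a_n, b_n, …, b_1`. -/
def symbolList (n : ℕ) : List (Fin n ⊕ Fin n) :=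
  (List.finRange n).map Sum.inl ++ (List.finRange n).reverse.map Sum.inr

/-- A permutation of the indices only reorders the commuting pairs `a_j b_j`. Applied to the
conjugation of indices, this makes `f` real. -/
theorem mono_map_perm {m : ℕ} {v : Fin m → Fin n ⊕ Fin n} (hv : List.ofFn v = symbolList n)
    (τ : Equiv.Perm (Fin n)) : mono (Sum.map τ τ ∘ v) = mono v := by
  have h : (symbolList n).map (Sum.map τ τ) = ((List.finRange n).map τ).map Sum.inl ++
      ((List.finRange n).map τ).reverse.map Sum.inr := by
    simp [symbolList, ← List.map_reverse, Function.comp_def]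
  rw [mono_eq_prod, mono_eq_prod, ← List.map_ofFn, hv, h, prod_append_reverse_eq_pairProd,
    symbolList, prod_append_reverse_eq_pairProd]
  exact pairProd_perm (Equiv.Perm.map_finRange_perm τ)

theorem surjective_of_ofFn_eq {m : ℕ} {v : Fin m → Fin n ⊕ Fin n}
    (hv : List.ofFn v = symbolList n) : Function.Surjective v := by
  intro i
  have : i ∈ List.ofFn v := by
    rw [hv]
    rcases i with j | j <;> simp [symbolList]
  simpa [List.mem_ofFn] using this

end PairedProducts

/-! ### The soliton data attached to the parameters -/

namespace ABParams

variable (P : ABParams)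

/-- The nondegeneracy conditions on the parameters. -/
structure Regular : Prop where
  σ_ne : P.σ ≠ 0
  p_ne : ∀ n ∈ Finset.Icc (P.M₁ + 1) P.M, P.p n ≠ 0
  k_ne : ∀ j ∈ Finset.Icc 1 P.N, P.k j ≠ 0
  k_add : ∀ j ∈ Finset.Icc 1 P.N, ∀ l ∈ Finset.Icc 1 P.N, j ≠ l → P.k j + P.k l ≠ 0
  k_add_conj : ∀ j ∈ Finset.Icc 1 P.N, ∀ l ∈ Finset.Icc 1 P.N, P.k j + conj (P.k l) ≠ 0
  k_sub_conj : ∀ j ∈ Finset.Icc 1 P.N, ∀ l ∈ Finset.Icc 1 P.N, P.k j - conj (P.k l) ≠ 0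
  factor_ne : ∀ j ∈ Finset.Icc 1 P.N, ∀ l ∈ Finset.Icc 1 P.N,
    P.factor (P.k j) (conj (P.k l)) ≠ 0

/-- The involution `j ↔ N + j` of the soliton indices. -/
def conjIndex : Equiv.Perm (Fin (2 * P.N)) :=
  Function.Involutive.toPerm
    (fun j => if h : (j : ℕ) < P.N then ⟨j + P.N, by omega⟩ else ⟨j - P.N, by omega⟩)
    (fun j => by
      by_cases h : (j : ℕ) < P.N
      · simp [h]
      · have : (j : ℕ) - P.N < P.N := by omega
        simp [h, this]
        ext
        simp
        omega)

variable {P}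

theorem conjIndex_apply (j : Fin (2 * P.N)) : P.conjIndex j =
    if h : (j : ℕ) < P.N then ⟨j + P.N, by omega⟩ else ⟨j - P.N, by omega⟩ := rfl

theorem conjIndex_of_lt {j : Fin (2 * P.N)} (h : (j : ℕ) < P.N) :
    (P.conjIndex j : ℕ) = j + P.N := by
  simp [conjIndex_apply, h]

theorem conjIndex_of_ge {j : Fin (2 * P.N)} (h : ¬ (j : ℕ) < P.N) :
    (P.conjIndex j : ℕ) = j - P.N := by
  simp [conjIndex_apply, h]

theorem conjIndex_conjIndex (j : Fin (2 * P.N)) : P.conjIndex (P.conjIndex j) = j := by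
  exact (Function.Involutive.toPerm_involutive _) j

theorem ext_of_lt (c : ℕ → ℂ) {j : ℕ} (h : j < P.N) : P.ext c (j + 1) = c (j + 1) := by
  simp [ext, Nat.succ_le_of_lt h]

theorem ext_of_ge (c : ℕ → ℂ) {j : ℕ} (h : ¬ j < P.N) :
    P.ext c (j + 1) = conj (c (j - P.N + 1)) := by
  have : ¬ j + 1 ≤ P.N := by omega
  simp [ext, this, show j + 1 - P.N = j - P.N + 1 by omega]

theorem conj_ext (c : ℕ → ℂ) (j : Fin (2 * P.N)) :
    conj (P.ext c (j + 1)) = P.ext c (P.conjIndex j + 1) := by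
  by_cases h : (j : ℕ) < P.N
  · rw [conjIndex_of_lt h, ext_of_lt c h, ext_of_ge c (by omega), Nat.add_sub_cancel]
  · rw [conjIndex_of_ge h, ext_of_ge c h, ext_of_lt c (by omega), Complex.conj_conj]

theorem sgn_of_lt {j : ℕ} (h : j < P.N) : P.sgn (j + 1) = 1 := by
  simp [sgn, Nat.succ_le_of_lt h]

theorem sgn_of_ge {j : ℕ} (h : ¬ j < P.N) : P.sgn (j + 1) = -1 := by
  have : ¬ j + 1 ≤ P.N := by omega
  simp [sgn, this]

theorem sgn_conjIndex (j : Fin (2 * P.N)) : P.sgn (P.conjIndex j + 1) = -P.sgn (j + 1) := by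
  by_cases h : (j : ℕ) < P.N
  · rw [conjIndex_of_lt h, sgn_of_lt h, sgn_of_ge (by omega)]
  · rw [conjIndex_of_ge h, sgn_of_ge h, sgn_of_lt (by omega), neg_neg]

theorem conj_sgn (j : ℕ) : conj (P.sgn j) = P.sgn j := by
  unfold sgn; split_ifs <;> simp

theorem factor_comm (z z' : ℂ) : P.factor z z' = P.factor z' z := by
  simp only [factor, mul_comm (_ + z ^ 2)]

theorem conj_factor (z z' : ℂ) : conj (P.factor z z') = P.factor (conj z) (conj z') := by
  simp [factor, map_ofNat]

namespace Regular

variable (hP : P.Regular)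
include hP

theorem w_add_ne (j l : Fin (2 * P.N)) : P.w (j + 1) + P.w (l + 1) ≠ 0 := by
  have hk : ∀ i i' : ℕ, i < P.N → i' < P.N → P.k (i + 1) + P.k (i' + 1) ≠ 0 := fun i i' hi hi' => by
    have h₁ : i + 1 ∈ Finset.Icc 1 P.N := by simp; omega
    have h₂ : i' + 1 ∈ Finset.Icc 1 P.N := by simp; omega
    by_cases h : i = i'
    · rw [h, ← two_mul]
      exact mul_ne_zero two_ne_zero (hP.k_ne _ h₂)
    · exact hP.k_add _ h₁ _ h₂ (by omega)
  have hkc : ∀ i i' : ℕ, i < P.N → i' < P.N → P.k (i + 1) + conj (P.k (i' + 1)) ≠ 0 :=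
    fun i i' hi hi' => hP.k_add_conj _ (by simp; omega) _ (by simp; omega)
  unfold w
  by_cases hj : (j : ℕ) < P.N <;> by_cases hl : (l : ℕ) < P.N
  · rw [ext_of_lt _ hj, ext_of_lt _ hl]
    exact hk _ _ hj hl
  · rw [ext_of_lt _ hj, ext_of_ge _ hl]
    exact hkc _ _ hj (by omega)
  · rw [ext_of_ge _ hj, ext_of_lt _ hl, add_comm]
    exact hkc _ _ hl (by omega)
  · rw [ext_of_ge _ hj, ext_of_ge _ hl, ← map_add]
    exact (map_ne_zero _).2 (hk _ _ (by omega) (by omega))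

theorem w_ne (j : Fin (2 * P.N)) : P.w (j + 1) ≠ 0 := fun h =>
  hP.w_add_ne j j (by rw [h, add_zero])

/-- The condition on `k_j + k_j^*` means `Re k_j ≠ 0`. If `p² + k_j² = 0`, the imaginary part forces
`k_j` to be real, and then the sum is positive. -/
theorem pole_ne (n : ℕ) (j : Fin (2 * P.N)) : (P.p n : ℂ) ^ 2 + P.w (j + 1) ^ 2 ≠ 0 := by
  have hk : ∀ i : ℕ, i < P.N → (P.p n : ℂ) ^ 2 + P.k (i + 1) ^ 2 ≠ 0 := fun i hi h => by
    have hi' : i + 1 ∈ Finset.Icc 1 P.N := by simp; omega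
    have h₁ := hP.k_add_conj _ hi' _ hi'
    rw [Complex.add_conj] at h₁
    have hre : (P.k (i + 1)).re ≠ 0 := fun h => h₁ (by simp [h])
    have him := congrArg Complex.im h
    have hre' := congrArg Complex.re h
    simp only [sq, Complex.add_im, Complex.add_re, Complex.mul_im, Complex.mul_re,
      Complex.ofReal_re, Complex.ofReal_im, Complex.zero_im, Complex.zero_re] at him hre'
    have him' : (P.k (i + 1)).im = 0 := by
      refine (mul_eq_zero.1 (?_ : (P.k (i + 1)).re * (P.k (i + 1)).im = 0)).resolve_left hre
      linarith
    rw [him'] at hre'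
    have := mul_self_pos.2 hre
    nlinarith [mul_self_nonneg (P.p n)]
  unfold w
  by_cases hj : (j : ℕ) < P.N
  · rw [ext_of_lt _ hj]
    exact hk _ hj
  · rw [ext_of_ge _ hj]
    intro h
    refine hk (j - P.N) (by omega) ?_
    have := congrArg conj h
    simpa using this

theorem opposite_ne {j l : Fin (2 * P.N)} (hj : (j : ℕ) < P.N) (hl : ¬ (l : ℕ) < P.N) :
    P.w (j + 1) ^ 2 - P.w (l + 1) ^ 2 ≠ 0 ∧ P.factor (P.w (j + 1)) (P.w (l + 1)) ≠ 0 := by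
  have h := hP.w_add_ne j l
  unfold w at h ⊢
  rw [ext_of_lt _ hj, ext_of_ge _ hl] at h ⊢
  refine ⟨?_, hP.factor_ne _ (by simp; omega) _ (by simp; omega)⟩
  rw [sq_sub_sq]
  exact mul_ne_zero h (hP.k_sub_conj _ (by simp; omega) _ (by simp; omega))

end Regular

/-- The entries `(b_j, b_l)`. -/
noncomputable def bMatrix (P : ABParams) : Matrix (Fin (2 * P.N)) (Fin (2 * P.N)) ℂ :=
  Matrix.of fun j l =>
    ((1 - P.sgn (j + 1) * P.sgn (l + 1)) *
      ∑ n ∈ Finset.Icc 1 P.M₁, P.α' n (j + 1) * P.α' n (l + 1)) /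
        (2 * (P.w (j + 1) ^ 2 - P.w (l + 1) ^ 2) * P.factor (P.w (j + 1)) (P.w (l + 1)))

theorem bMatrix_skew (j l : Fin (2 * P.N)) : P.bMatrix l j = -P.bMatrix j l := by
  have h : 2 * (P.w (j + 1) ^ 2 - P.w (l + 1) ^ 2) * P.factor (P.w (j + 1)) (P.w (l + 1)) =
      -(2 * (P.w (l + 1) ^ 2 - P.w (j + 1) ^ 2) * P.factor (P.w (l + 1)) (P.w (j + 1))) := by
    rw [factor_comm]; ring
  simp only [bMatrix, Matrix.of_apply, h, div_neg, neg_neg]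
  congr 2
  · ring
  · exact Finset.sum_congr rfl fun n _ => mul_comm _ _

theorem conj_bMatrix (j l : Fin (2 * P.N)) :
    conj (P.bMatrix j l) = P.bMatrix (P.conjIndex j) (P.conjIndex l) := by
  simp only [bMatrix, Matrix.of_apply, map_div₀, map_mul, map_sub, map_sum, map_one, map_pow,
    map_ofNat, conj_sgn, conj_factor, w, α', conj_ext, sgn_conjIndex, neg_mul_neg]

/-- The entries `(b_j, β_n)`. -/
noncomputable def polarization (P : ABParams) (n : ℕ) (j : Fin (2 * P.N)) : ℂ :=
  (1 + P.sgn (j + 1)) / 2 * P.α' n (j + 1)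

theorem conj_polarization_conjIndex (n : ℕ) (j : Fin (2 * P.N)) :
    conj (P.polarization n (P.conjIndex j)) = (1 - P.sgn (j + 1)) / 2 * P.α' n (j + 1) := by
  simp only [polarization, map_mul, map_div₀, map_add, map_one, map_ofNat, sgn_conjIndex, map_neg,
    conj_sgn, α', conj_ext, conjIndex_conjIndex]
  ring

theorem Regular.bMatrix_constraint (hP : P.Regular) (j l : Fin (2 * P.N)) :
    P.factor (P.w (j + 1)) (P.w (l + 1)) * ((P.w (j + 1) ^ 2 - P.w (l + 1) ^ 2) * P.bMatrix j l) =
    ∑ n ∈ Finset.Icc 1 P.M₁, (P.polarization n j * conj (P.polarization n (P.conjIndex l)) +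
      conj (P.polarization n (P.conjIndex j)) * P.polarization n l) := by
  have hR : ∑ n ∈ Finset.Icc 1 P.M₁, (P.polarization n j *
      conj (P.polarization n (P.conjIndex l)) +
      conj (P.polarization n (P.conjIndex j)) * P.polarization n l) =
      (1 - P.sgn (j + 1) * P.sgn (l + 1)) / 2 *
        ∑ n ∈ Finset.Icc 1 P.M₁, P.α' n (j + 1) * P.α' n (l + 1) := by
    rw [Finset.mul_sum]
    refine Finset.sum_congr rfl fun n _ => ?_
    rw [conj_polarization_conjIndex, conj_polarization_conjIndex, polarization, polarization]
    ring
  -- For equal signs the numerator vanishes, so the entry is `0` whatever its denominator, which is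
  -- zero for `j = l`; for opposite signs the denominator is nonzero.
  have hne : P.sgn (j + 1) * P.sgn (l + 1) = 1 ∨ (P.w (j + 1) ^ 2 - P.w (l + 1) ^ 2 ≠ 0 ∧
      P.factor (P.w (j + 1)) (P.w (l + 1)) ≠ 0) := by
    by_cases hj : (j : ℕ) < P.N <;> by_cases hl : (l : ℕ) < P.N
    · left; rw [sgn_of_lt hj, sgn_of_lt hl]; norm_num
    · right; exact hP.opposite_ne hj hl
    · right
      have := hP.opposite_ne hl hj
      rw [factor_comm, ← neg_sub, neg_ne_zero]
      exact this
    · left; rw [sgn_of_ge hj, sgn_of_ge hl]; norm_num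
  rw [hR, bMatrix, Matrix.of_apply]
  rcases hne with h | ⟨h₁, h₂⟩
  · simp [h]
  · field_simp

/-- The algebraic data of the bright-dark soliton solution. -/
noncomputable def Regular.data (hP : P.Regular) : SolitonData (Fin (2 * P.N)) where
  w j := P.w (j + 1)
  τ := P.conjIndex
  B := P.bMatrix
  σ := P.σ
  bright := Finset.Icc 1 P.M₁
  dark := Finset.Icc (P.M₁ + 1) P.M
  β := P.polarization
  p := P.p
  r := P.r
  σ_ne := hP.σ_ne
  w_add_ne := hP.w_add_ne
  pole_ne n _ j := hP.pole_ne n j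
  τ_τ := conjIndex_conjIndex
  conj_w := conj_ext P.k
  conj_B := conj_bMatrix
  B_skew := by ext j l; exact bMatrix_skew j l
  constraint j l := by
    rw [← hP.bMatrix_constraint, factor, add_mul, Finset.sum_mul]
    congr 1
    refine Finset.sum_congr rfl fun n _ => ?_
    have h₁ := hP.pole_ne n j
    have h₂ := hP.pole_ne n l
    field_simp
    ring

end ABParams

/-! ### Translation of the given Pfaffians and the two bilinear equations -/

namespace ABParams

open PfSymbol

variable {P : ABParams}

/-- The Pfaffian symbol of an index. -/
def sym {n : ℕ} : Fin n ⊕ Fin n → PfSymbol := Sum.elim (fun j => a (j + 1)) fun j => b (j + 1)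

theorem bullet_eq_map : P.bullet = (symbolList (2 * P.N)).map sym := by
  have h : List.range' 1 (2 * P.N) = (List.finRange (2 * P.N)).map fun j : Fin (2 * P.N) => j.val + 1 := by
    apply List.ext_getElem <;> simp [add_comm]
  simp [bullet, symbolList, h, sym, Function.comp_def, ← List.map_reverse]

/-- The symbols `a_1, …, a_{2N}, b_{2N}, …, b_1` as a family. -/
def bulletFamily (P : ABParams) (i : Fin P.bullet.length) : Fin (2 * P.N) ⊕ Fin (2 * P.N) :=
  (symbolList (2 * P.N)).get (i.cast (by rw [bullet_eq_map, List.length_map]))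

theorem ofFn_bulletFamily : List.ofFn P.bulletFamily = symbolList (2 * P.N) := by
  apply List.ext_getElem
  · simp [bullet_eq_map]
  · simp [bulletFamily]

theorem bullet_get (i : Fin P.bullet.length) : P.bullet.get i = sym (P.bulletFamily i) := by
  have h := P.bullet_eq_map
  simp only [bulletFamily, List.get_eq_getElem, Fin.val_cast, h, List.getElem_map]

/-- The amplitudes `exp η_j`. -/
noncomputable def amp (P : ABParams) (x t : ℝ) (j : Fin (2 * P.N)) : ℂ :=
  Complex.exp (P.η x t (j + 1))

theorem conj_amp (x t : ℝ) (j : Fin (2 * P.N)) : conj (P.amp x t j) = P.amp x t (P.conjIndex j) := by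
  simp only [amp, ← Complex.exp_conj, η, conj_ext]

theorem η_eq (x t : ℝ) (j : ℕ) :
    P.η x t j = P.w j * x + ((P.μ + P.lam : ℝ) : ℂ) / P.w j * t + P.ext P.η₀ j := by
  unfold η w ext
  split_ifs <;> simp

theorem hasDerivAt_amp_space (x t : ℝ) (j : Fin (2 * P.N)) :
    HasDerivAt (fun x => P.amp x t j) (P.w (j + 1) * P.amp x t j) x := by
  simp only [amp, η_eq]
  have h := ((((Complex.ofRealCLM.hasDerivAt (x := x)).const_mul (P.w (j + 1))).add_const
    (((P.μ + P.lam : ℝ) : ℂ) / P.w (j + 1) * t)).add_const (P.ext P.η₀ (j + 1))).cexp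
  refine h.congr_deriv ?_
  simp
  ring

theorem hasDerivAt_amp_time (x t : ℝ) (j : Fin (2 * P.N)) :
    HasDerivAt (fun t => P.amp x t j)
      (((P.μ + P.lam : ℝ) : ℂ) / P.w (j + 1) * P.amp x t j) t := by
  simp only [amp, η_eq]
  have h := ((((Complex.ofRealCLM.hasDerivAt (x := t)).const_mul
    (((P.μ + P.lam : ℝ) : ℂ) / P.w (j + 1))).const_add (P.w (j + 1) * x)).add_const
    (P.ext P.η₀ (j + 1))).cexp
  refine h.congr_deriv ?_
  simp
  ring

theorem contDiff_amp (j : Fin (2 * P.N)) {k : WithTop ℕ∞} :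
    ContDiff ℝ k fun q : ℝ × ℝ => P.amp q.1 q.2 j := by
  simp only [amp, η_eq]
  have h : ContDiff ℝ k fun s : ℝ => (s : ℂ) := Complex.ofRealCLM.contDiff
  exact (((contDiff_const.mul (h.comp contDiff_fst)).add
    (contDiff_const.mul (h.comp contDiff_snd))).add contDiff_const).cexp

theorem ι_mul_mono_bulletFamily (v : Fin (2 * P.N) ⊕ Fin (2 * P.N) → ℂ) :
    ExteriorAlgebra.ι ℂ v * mono P.bulletFamily = 0 :=
  ι_mul_mono_eq_zero (surjective_of_ofFn_eq ofFn_bulletFamily) v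

variable (hP : P.Regular)
include hP

theorem entry_sym (x t : ℝ) (i i' : Fin (2 * P.N) ⊕ Fin (2 * P.N)) :
    P.entry x t (sym i) (sym i') = hP.data.form (P.amp x t) i i' := by
  rcases i with j | j <;> rcases i' with l | l <;>
    simp [sym, entry, SolitonData.form, cauchyMatrix, Regular.data, amp, Complex.exp_add,
      Matrix.one_apply, bMatrix, ← Fin.ext_iff, eq_comm]

theorem f_eq (x t : ℝ) : P.f x t = wick (hP.data.form (P.amp x t)) (mono P.bulletFamily) := by
  rw [f, pfaffianList, ← pfaffian_eq_wick (hP.data.form_skew _)]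
  congr 1
  ext i j
  simp only [Matrix.of_apply, bullet_get, entry_sym hP]

theorem pfaffianList_cons_cons (x t : ℝ) (s s' : PfSymbol) :
    pfaffianList (P.entry x t) (s :: s' :: P.bullet) =
      P.entry x t s s' * wick (hP.data.form (P.amp x t)) (mono P.bulletFamily) +
      wick (hP.data.form (P.amp x t)) (contr (fun i => P.entry x t s (sym i))
        (contr (fun i => P.entry x t s' (sym i)) (mono P.bulletFamily))) := by
  refine (pfaffian_cons_cons (hP.data.form_skew _) P.bulletFamily (fun i => P.entry x t s (sym i))
    (fun i => P.entry x t s' (sym i)) _ ?_ ?_ ?_).trans rfl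
  · intro j
    simp [← bullet_get]
  · intro j
    simp [← bullet_get]
  · intro i j
    rw [← entry_sym hP, ← bullet_get, ← bullet_get]
    rfl

theorem entry_d (x t : ℝ) (l : ℤ) :
    (fun i => P.entry x t (d l) (sym i)) = hP.data.dRow (P.amp x t) l := by
  ext (j | j) <;> simp [sym, entry, SolitonData.dRow, Regular.data, amp]

theorem entry_β (x t : ℝ) (n : ℕ) :
    (fun i => P.entry x t (β n) (sym i)) = hP.data.brightRow n := by
  ext (j | j) <;> simp [sym, entry, SolitonData.brightRow, Regular.data, polarization]

theorem Regular.w_add_I_mul_ne (n : ℕ) (j : Fin (2 * P.N)) :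
    P.w (j + 1) + Complex.I * P.p n ≠ 0 := fun h => by
  refine hP.pole_ne n j ?_
  have : (P.p n : ℂ) ^ 2 + P.w (j + 1) ^ 2 =
      (P.w (j + 1) + Complex.I * P.p n) * (P.w (j + 1) - Complex.I * P.p n) := by
    linear_combination (P.p n : ℂ) ^ 2 * Complex.I_sq
  rw [this, h, zero_mul]

/-- From `2ip/(w + ip) = 1 - (w - ip)/(w + ip)`. After contraction with the row of `d_0` its
multiple drops out, so `γ_n` acts as `r_n` times an extra wave symbol with wave number `i p_n`. -/
theorem entry_γ (x t : ℝ) (n : ℕ) :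
    (fun i => P.entry x t (γ n) (sym i)) =
      (P.r n : ℂ) • (hP.data.waveRow (P.amp x t) (Complex.I * P.p n) -
        hP.data.dRow (P.amp x t) 0) := by
  ext (j | j)
  · have := hP.w_add_I_mul_ne n j
    simp only [sym, entry, SolitonData.waveRow, SolitonData.dRow, Regular.data, amp, Sum.elim_inl,
      Pi.smul_apply, Pi.sub_apply, smul_eq_mul, zpow_zero]
    field_simp
    ring
  · simp [sym, entry, SolitonData.waveRow, SolitonData.dRow]

theorem g_bright {n : ℕ} (hn : n ≤ P.M₁) (x t : ℝ) :
    P.g n x t = wick (hP.data.form (P.amp x t)) (contr (hP.data.dRow (P.amp x t) 0)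
      (contr (hP.data.brightRow n) (mono P.bulletFamily))) := by
  rw [g, if_pos hn, pfaffianList_cons_cons hP, entry_d hP, entry_β hP]
  simp [entry]

theorem g_dark {n : ℕ} (hn : ¬ n ≤ P.M₁) (x t : ℝ) :
    P.g n x t = P.r n * Complex.exp (Complex.I * P.φ x t n) *
      (wick (hP.data.form (P.amp x t)) (mono P.bulletFamily) +
        wick (hP.data.form (P.amp x t)) (contr (hP.data.dRow (P.amp x t) 0)
          (contr (hP.data.waveRow (P.amp x t) (Complex.I * P.p n)) (mono P.bulletFamily)))) := by
  rw [g, if_neg hn, pfaffianList_cons_cons hP, entry_d hP, entry_γ hP]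
  simp only [entry, contr_smul, contr_sub, contr_self, map_smul, map_sub, smul_eq_mul, if_true,
    map_zero]
  ring

theorem Regular.hirotaD_bright {n : ℕ} (hn : n ≤ P.M₁) (x t : ℝ) :
    hirotaD 1 1 (P.g n) P.f x t = ((P.μ + P.lam : ℝ) : ℂ) * (P.g n x t * P.f x t) := by
  have h := hP.data.hirotaD_component (e := P.amp) (c := ((P.μ + P.lam : ℝ) : ℂ))
    -- A bright row is constant and has zero background, so any nonzero wave number, here `1`, will
    -- do.
    hasDerivAt_amp_space hasDerivAt_amp_time ι_mul_mono_bulletFamily (h := fun _ _ => 0)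
    (ζ := fun _ _ => hP.data.brightRow n) one_ne_zero
    (fun x t => (hasDerivAt_const _ _).congr_deriv (by simp))
    (fun x t => (hasDerivAt_const _ _).congr_deriv (by simp))
    (fun x t i => (hasDerivAt_const _ _).congr_deriv (by simp))
    (fun x t i => (hasDerivAt_const _ _).congr_deriv (by simp)) x t
  simp only [zero_mul, zero_add, ← g_bright hP hn, ← f_eq hP] at h
  exact h

theorem Regular.hirotaD_dark {n : ℕ} (hn : ¬ n ≤ P.M₁) (hn' : n ≤ P.M) (x t : ℝ) :
    hirotaD 1 1 (P.g n) P.f x t = ((P.μ + P.lam : ℝ) : ℂ) * (P.g n x t * P.f x t) := by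
  have hp : P.p n ≠ 0 := hP.p_ne n (by simp; omega)
  have hp' : (P.p n : ℂ) ≠ 0 := by exact_mod_cast hp
  have hz : Complex.I * P.p n ≠ 0 := mul_ne_zero Complex.I_ne_zero hp'
  -- The background `r_n e^{iφ_n}` obeys the evolution of a soliton amplitude with wave number `z =
  -- i p_n`, because `(μ+λ)/z = -i(μ+λ)/p_n`.
  have hhx : ∀ x t : ℝ, HasDerivAt (fun x => P.r n * Complex.exp (Complex.I * P.φ x t n))
      (Complex.I * P.p n * (P.r n * Complex.exp (Complex.I * P.φ x t n))) x := fun x t => by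
    have hφ : HasDerivAt (fun x => P.φ x t n) (P.p n) x := by
      simpa [φ] using (((hasDerivAt_id x).const_mul (P.p n)).sub_const
        ((P.μ + P.lam) / P.p n * t)).add_const (P.φ₀ n)
    refine (((hφ.ofReal_comp.const_mul Complex.I).cexp).const_mul (P.r n : ℂ)).congr_deriv ?_
    ring
  have hht : ∀ x t : ℝ, HasDerivAt (fun t => P.r n * Complex.exp (Complex.I * P.φ x t n))
      (((P.μ + P.lam : ℝ) : ℂ) / (Complex.I * P.p n) *
        (P.r n * Complex.exp (Complex.I * P.φ x t n))) t := fun x t => by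
    have hφ : HasDerivAt (fun t => P.φ x t n) (-((P.μ + P.lam) / P.p n)) t := by
      simpa [φ] using (((hasDerivAt_id t).const_mul ((P.μ + P.lam) / P.p n)).const_sub
        (P.p n * x)).add_const (P.φ₀ n)
    refine (((hφ.ofReal_comp.const_mul Complex.I).cexp).const_mul (P.r n : ℂ)).congr_deriv ?_
    push_cast
    have hI := Complex.I_sq
    have hI' := Complex.I_ne_zero
    field_simp
    linear_combination (-(P.r n : ℂ) * (P.μ + P.lam)) * hI
  have h := hP.data.hirotaD_component (e := P.amp) (c := ((P.μ + P.lam : ℝ) : ℂ))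
    hasDerivAt_amp_space hasDerivAt_amp_time ι_mul_mono_bulletFamily
    (ζ := fun x t => (P.r n * Complex.exp (Complex.I * P.φ x t n)) •
      hP.data.waveRow (P.amp x t) (Complex.I * P.p n)) hz hhx hht ?_ ?_ x t
  · simp only [contr_smul, map_smul, smul_eq_mul, ← mul_add] at h
    rw [show P.g n = _ from funext₂ (g_dark hP hn), show P.f = _ from funext₂ (f_eq hP)]
    exact h
  · rintro x t (j | j)
    · have hw := hP.w_add_I_mul_ne n j
      refine ((hhx x t).mul ((hasDerivAt_amp_space x t j).const_mul ((P.w (j + 1) -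
        Complex.I * P.p n) / (P.w (j + 1) + Complex.I * P.p n)))).congr_deriv ?_
      simp only [SolitonData.dRow, Regular.data, Sum.elim_inl, Pi.smul_apply, Pi.sub_apply,
        smul_eq_mul, zpow_zero, zpow_one]
      field_simp
      ring
    · refine ((hhx x t).mul (hasDerivAt_const x (0 : ℂ))).congr_deriv ?_
      simp [SolitonData.dRow]
  · rintro x t (j | j)
    · have hw := hP.w_add_I_mul_ne n j
      have hw' := hP.w_ne j
      refine ((hht x t).mul ((hasDerivAt_amp_time x t j).const_mul ((P.w (j + 1) -
        Complex.I * P.p n) / (P.w (j + 1) + Complex.I * P.p n)))).congr_deriv ?_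
      simp only [SolitonData.dRow, Regular.data, Sum.elim_inl, Pi.smul_apply, Pi.sub_apply,
        smul_eq_mul, zpow_zero, _root_.zpow_neg_one]
      generalize Complex.I * (P.p n : ℂ) = z at *
      field_simp
    · refine ((hht x t).mul (hasDerivAt_const t (0 : ℂ))).congr_deriv ?_
      simp [SolitonData.dRow]

theorem Regular.energy {r : ℝ} (hM : P.M₁ ≤ P.M)
    (hr : r ^ 2 = ∑ n ∈ Finset.Icc (P.M₁ + 1) P.M, P.r n ^ 2) (x t : ℝ) :
    hirotaD 2 0 P.f P.f x t + ((r ^ 2 * P.σ : ℝ) : ℂ) * (P.f x t * P.f x t) =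
      (P.σ : ℂ) * ∑ j ∈ Finset.Icc 1 P.M, ((‖P.g j x t‖ ^ 2 : ℝ) : ℂ) := by
  have h := hP.data.energy (P.amp x t) (conj_amp x t)
    (surjective_of_ofFn_eq ofFn_bulletFamily) (mono_map_perm ofFn_bulletFamily P.conjIndex)
  have hτ := hP.data.hirotaD_tau hasDerivAt_amp_space (mono P.bulletFamily) x t
  rw [← hτ] at h
  simp only [← f_eq hP] at h
  have hsplit : Finset.Icc 1 P.M = Finset.Icc 1 P.M₁ ∪ Finset.Icc (P.M₁ + 1) P.M := by
    ext n; simp; omega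
  have hdisj : Disjoint (Finset.Icc 1 P.M₁) (Finset.Icc (P.M₁ + 1) P.M) := by
    rw [Finset.disjoint_left]
    intro n hn hn'
    simp at hn hn'
    omega
  have hb : ∀ n ∈ Finset.Icc 1 P.M₁, ((‖P.g n x t‖ ^ 2 : ℝ) : ℂ) =
      ((‖wick (hP.data.form (P.amp x t)) (contr (hP.data.dRow (P.amp x t) 0)
        (contr (hP.data.brightRow n) (mono P.bulletFamily)))‖ ^ 2 : ℝ) : ℂ) := fun n hn => by
    rw [g_bright hP (Finset.mem_Icc.1 hn).2]
  have hd : ∀ n ∈ Finset.Icc (P.M₁ + 1) P.M, ((‖P.g n x t‖ ^ 2 : ℝ) : ℂ) =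
      (P.r n : ℂ) ^ 2 * ((‖P.f x t + wick (hP.data.form (P.amp x t))
        (contr (hP.data.dRow (P.amp x t) 0) (contr (hP.data.waveRow (P.amp x t)
          (Complex.I * P.p n)) (mono P.bulletFamily)))‖ ^ 2 : ℝ) : ℂ) := fun n hn => by
    have hn' : ¬ n ≤ P.M₁ := by simp at hn; omega
    rw [g_dark hP hn', ← f_eq hP, norm_mul, norm_mul, Complex.norm_exp_I_mul_ofReal, mul_one,
      mul_pow, Complex.norm_real, Real.norm_eq_abs, sq_abs]
    push_cast
    ring
  rw [hsplit, Finset.sum_union hdisj, Finset.sum_congr rfl hb, Finset.sum_congr rfl hd]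
  refine Eq.trans ?_ h
  rw [hr]
  simp only [Regular.data]
  push_cast
  ring

open scoped ContDiff

theorem Regular.contDiff_f : ContDiff ℝ ∞ fun q : ℝ × ℝ => P.f q.1 q.2 := by
  simp only [f_eq hP]
  exact contDiff_wick (fun _ => hP.data.form_skew _) (hP.data.contDiff_form fun j => contDiff_amp j) _

theorem Regular.contDiff_g (n : ℕ) : ContDiff ℝ ∞ fun q : ℝ × ℝ => P.g n q.1 q.2 := by
  have hform := hP.data.contDiff_form (k := ∞) (e := fun q : ℝ × ℝ => P.amp q.1 q.2)
    fun j => contDiff_amp j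
  have hdr := hP.data.contDiff_dRow (k := ∞) (e := fun q : ℝ × ℝ => P.amp q.1 q.2)
    (fun j => contDiff_amp j) 0
  have hwave := hP.data.contDiff_waveRow (k := ∞) (e := fun q : ℝ × ℝ => P.amp q.1 q.2)
    (fun j => contDiff_amp j) (Complex.I * P.p n)
  by_cases hn : n ≤ P.M₁
  · simp only [g_bright hP hn]
    exact contDiff_wick_contr_contr (ε := fun _ => hP.data.brightRow n)
      (fun _ => hP.data.form_skew _) hform hdr (fun i => contDiff_const) _
  · simp only [g_dark hP hn]
    refine ContDiff.mul (contDiff_const.mul (ContDiff.cexp (contDiff_const.mul ?_)))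
      ((contDiff_wick (fun _ => hP.data.form_skew _) hform _).add
      (contDiff_wick_contr_contr (fun _ => hP.data.form_skew _) hform hdr hwave _))
    have h : ContDiff ℝ ∞ fun s : ℝ => (s : ℂ) := Complex.ofRealCLM.contDiff
    refine h.comp ?_
    unfold φ
    fun_prop

end ABParams

end

open scoped ContDiff ComplexConjugate in
theorem theorem2 (P : ABParams) (r : ℝ)
    (hM₁ : 1 ≤ P.M₁) (hM : P.M₁ ≤ P.M)
    (hσ : P.σ ≠ 0)
    (hr : r ^ 2 = ∑ n ∈ Finset.Icc (P.M₁ + 1) P.M, P.r n ^ 2)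
    (hp : ∀ n ∈ Finset.Icc (P.M₁ + 1) P.M, P.p n ≠ 0)
    (hk : ∀ j ∈ Finset.Icc 1 P.N, P.k j ≠ 0)
    (hk_add : ∀ j ∈ Finset.Icc 1 P.N, ∀ l ∈ Finset.Icc 1 P.N, j ≠ l → P.k j + P.k l ≠ 0)
    (hk_add_conj : ∀ j ∈ Finset.Icc 1 P.N, ∀ l ∈ Finset.Icc 1 P.N, P.k j + conj (P.k l) ≠ 0)
    (hk_sub_conj : ∀ j ∈ Finset.Icc 1 P.N, ∀ l ∈ Finset.Icc 1 P.N, P.k j - conj (P.k l) ≠ 0)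
    (hfactor : ∀ j ∈ Finset.Icc 1 P.N, ∀ l ∈ Finset.Icc 1 P.N,
      P.factor (P.k j) (conj (P.k l)) ≠ 0) :
    ContDiff ℝ ∞ (fun q : ℝ × ℝ => P.f q.1 q.2) ∧
    (∀ j ∈ Finset.Icc 1 P.M, ContDiff ℝ ∞ (fun q : ℝ × ℝ => P.g j q.1 q.2)) ∧
    (∀ j ∈ Finset.Icc 1 P.M, ∀ x t : ℝ,
      hirotaD 1 1 (P.g j) P.f x t = ((P.μ + P.lam : ℝ) : ℂ) * (P.g j x t * P.f x t)) ∧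
    (∀ x t : ℝ,
      hirotaD 2 0 P.f P.f x t + ((r ^ 2 * P.σ : ℝ) : ℂ) * (P.f x t * P.f x t) =
        (P.σ : ℂ) * ∑ j ∈ Finset.Icc 1 P.M, ((‖P.g j x t‖ ^ 2 : ℝ) : ℂ)) := by
  have hP : P.Regular := ⟨hσ, hp, hk, hk_add, hk_add_conj, hk_sub_conj, hfactor⟩
  refine ⟨hP.contDiff_f, fun j _ => hP.contDiff_g j, fun j hj x t => ?_,
    fun x t => hP.energy hM hr x t⟩
  by_cases h : j ≤ P.M₁
  · exact hP.hirotaD_bright h x t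
  · exact hP.hirotaD_dark h (Finset.mem_Icc.1 hj).2 x t
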